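/- **Conventions.** A *convex set* is an algebra over the monad $D$ of finitely supported probability distributions with weights in $\mathbb{R}_{\ge 0}$; convex sets and convex maps (algebra morphisms) form the category $\mathsf{CSet}$. A map $X_1\times\cdots\times X_n\to Z$ between convex sets is *$n$-convex* if it is convex in each variable separately. The tensor product $X_1\otimes\cdots\otimes X_n$ is the convex set representing $n$-convex maps out of $X_1\times\cdots\times X_n$ (the quotient of $D(X_1\times\cdots\times X_n)$ by the convex equivalence relation generated by multilinearity; for $n=0$ it is a point, for $n=1$ it is $X_1$ itself). Let $\mathcal{O}$ be a symmetric one-coloured operad in sets. An *$\mathcal{O}$-monoidal category* is a category $\mathcal{C}$ with a functor $\otimes_z:\mathcal{C}^n\to\mathcal{C}$ for every $z\in\mathcal{O}(n)$ and natural isomorphisms $$\otimes_z(\otimes_{x_1}(\ldots),\ldots,\otimes_{x_m}(\ldots))\cong\otimes_{z\circ(x_1,\ldots,x_m)}(\ldots),\qquad \otimes_z(X_{\sigma(1)},\ldots,X_{\sigma(n)})\cong\otimes_{z\cdot\sigma^{-1}}(X_1,\ldots,X_n),$$ compatible with associativity, unitality and equivariance in $\mathcal{O}$, such that the operation of the operadic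 unit is the identity functor. A *lax $\mathcal{O}$-monoidal functor* is a functor $F$ with natural maps $\xi^z:\otimes_z(F(X_1),\ldots,F(X_n))\to F(\otimes_z(X_1,\ldots,X_n))$, equal to the identity for the operadic unit and commuting with the structure isomorphisms; it is *strict* if all $\xi^z$ are identities. An *$\mathcal{O}$-monoidal transformation* is a natural transformation commuting with the maps $\xi^z$. The tensor product makes $\mathsf{CSet}$ an $\mathcal{O}$-monoidal category $(\mathsf{CSet},\otimes)$, in which every $z\in\mathcal{O}(n)$ acts by the $n$-fold tensor product and the structure isomorphisms are the canonical ones. Let $(\mathcal{I},\odot)$ be a small $\mathcal{O}$-monoidal category. A functor $\pi:\mathcal{C}\to\mathcal{I}$ is a *discrete fibration* if for every object $e$ of $\mathcal{C}$ and every morphism $f:\pi(e)\to c$ there is a unique morphism with source $e$ lying over $f$. A *fibrewise convex structure* on $\pi$ consists of convex structures on the sets $\pi^{-1}(c)$ of objects over $c$ and $\pi^{-1}(f)$ of morphisms over $f$, for all objects $c$ and morphisms $f$ of $\mathcal{I}$, such that the source and target maps $\pi^{-1}(f)\to\pi^{-1}(c)$, $\pi^{-1}(f)\to\pi^{-1}(d)$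 (for $f:c\to d$) and the identity maps $\pi^{-1}(c)\to\pi^{-1}(\mathrm{id}_c)$ are convex. An *$\mathcal{O}$-convex fibration* over $\mathcal{I}$ is a small $\mathcal{O}$-monoidal category $(\mathcal{C},\boxtimes)$ with a strict $\mathcal{O}$-monoidal functor $\pi:\mathcal{C}\to\mathcal{I}$ that is a discrete fibration, together with a fibrewise convex structure on $\pi$, such that for all $z\in\mathcal{O}(n)$ and $i_1,\ldots,i_n\in\mathcal{I}$ the map $$\boxtimes_z:\pi^{-1}(i_1)\times\cdots\times\pi^{-1}(i_n)\to\pi^{-1}(\odot_z(i_1,\ldots,i_n))$$ is $n$-convex. A morphism of $\mathcal{O}$-convex fibrations is a strict $\mathcal{O}$-monoidal functor over $\mathcal{I}$ that is convex on all sets $\pi^{-1}(c)$ and $\pi^{-1}(f)$. This defines the category $\mathcal{O}\mathsf{CFib}_{\mathcal{I}}$. **Theorem (convex $\mathcal{O}$-monoidal Grothendieck construction).** Let $\mathcal{O}$ be a symmetric operad in sets and $(\mathcal{I},\odot)$ a small $\mathcal{O}$-monoidal category. For a lax $\mathcal{O}$-monoidal functor $(F,\xi):(\mathcal{I},\odot)\to(\mathsf{CSet},\otimes)$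 let $\int_{\mathcal{I}}F$ be the category of pairs $(i,x)$ with $i\in\mathcal{I}$ and $x\in F(i)$, a morphism $(i,x)\to(j,y)$ being a morphism $f:i\to j$ with $F(f)(x)=y$; equip it with the operations $$\boxtimes_z\bigl((i_1,x_1),\ldots,(i_n,x_n)\bigr)=\bigl(\odot_z(i_1,\ldots,i_n),\ \xi^z(x_1\otimes\cdots\otimes x_n)\bigr),$$ the structure isomorphisms of $\mathcal{I}$, the projection to $\mathcal{I}$, the convex structure of $F(i)$ on the fibre over $i$, and the convex structure on the set of morphisms over $f:c\to d$ that corresponds to $F(c)$ through the source. This is an $\mathcal{O}$-convex fibration, and with $\mu\mapsto\bigl((i,x)\mapsto(i,\mu_i(x))\bigr)$ on $\mathcal{O}$-monoidal transformations it defines a functor $$\int_{\mathcal{I}}^{\mathcal{O}}:\ \operatorname{Fun}^{\mathcal{O},\mathrm{lax}}\bigl((\mathcal{I},\odot),(\mathsf{CSet},\otimes)\bigr)\longrightarrow\mathcal{O}\mathsf{CFib}_{\mathcal{I}}$$ which is an equivalence of categories. -/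

import Mathlib

open CategoryTheory
open scoped NNReal

universe w v u v₁ u₁ v₂ u₂

namespace ConvexGC

/-! ### Symmetric operads in sets -/

/-- Transport of a bijection of pairs `(i, j)` to the lexicographic numbering of these pairs. -/
def lexEquiv {m m' : ℕ} {n : Fin m → ℕ} {n' : Fin m' → ℕ}
    (e : (Σ i, Fin (n i)) ≃ (Σ i, Fin (n' i))) : Fin (∑ i, n i) ≃ Fin (∑ i, n' i) :=
  finSigmaFinEquiv.symm.trans (e.trans finSigmaFinEquiv)

/-- The direct sum of bijections (permutations inside the blocks). -/
def blockSum {m : ℕ} {n n' : Fin m → ℕ} (σ : ∀ i, Fin (n i) ≃ Fin (n' i)) :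
    Fin (∑ i, n i) ≃ Fin (∑ i, n' i) :=
  lexEquiv (Equiv.sigmaCongrRight σ)

/-- The block permutation: the `j`-th entry of the `i`-th block goes to the `j`-th entry of
the block `σ i`. -/
def blockPerm {m m' : ℕ} (n : Fin m' → ℕ) (σ : Fin m ≃ Fin m') :
    Fin (∑ i, n (σ i)) ≃ Fin (∑ i, n i) :=
  lexEquiv (Equiv.sigmaCongrLeft (β := fun i => Fin (n i)) σ)

/-- The identification `1 * n = n` (identity on values). -/
def unitLeftEquiv (n : ℕ) : Fin (∑ _i : Fin 1, n) ≃ Fin n :=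
  finSigmaFinEquiv.symm.trans
    { toFun := fun p => p.2
      invFun := fun j => ⟨0, j⟩
      left_inv := fun ⟨i, j⟩ => by rw [Subsingleton.elim i 0]
      right_inv := fun _ => rfl }

/-- The identification `m * 1 = m` (identity on values). -/
def unitRightEquiv (m : ℕ) : Fin (∑ _i : Fin m, 1) ≃ Fin m :=
  finSigmaFinEquiv.symm.trans
    { toFun := fun p => p.1
      invFun := fun i => ⟨i, 0⟩
      left_inv := fun ⟨i, j⟩ => by rw [Subsingleton.elim j 0]
      right_inv := fun _ => rfl }

/-- The two lexicographic numberings of triples `(i, j, l)` agree: `(i, j), l` and `i, (j, l)`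
(identity on values). -/
def assocEquiv {m : ℕ} {n : Fin m → ℕ} (p : ∀ i, Fin (n i) → ℕ) :
    Fin (∑ k : Fin (∑ i, n i), p (finSigmaFinEquiv.symm k).1 (finSigmaFinEquiv.symm k).2) ≃
      Fin (∑ i, ∑ j, p i j) :=
  finSigmaFinEquiv.symm.trans <|
    (Equiv.sigmaCongrLeft
      (β := fun s : (Σ i, Fin (n i)) => Fin (p s.1 s.2)) finSigmaFinEquiv.symm).trans <|
    (Equiv.sigmaAssoc (fun i j => Fin (p i j))).trans <|
    (Equiv.sigmaCongrRight fun _ => finSigmaFinEquiv).trans finSigmaFinEquiv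

/-- A (monochromatic) symmetric operad in sets. The symmetric group actions are recorded as
`relabel σ : Op m → Op n` for bijections `σ : Fin m ≃ Fin n` (so `m = n`; for `σ` a
permutation this is the action of the symmetric group, for `σ` the identity on values it is the
transport along the equation `m = n`). Thinking of `z` as an operation,
`(relabel σ z) (a₁, …, aₙ) = z (a_{σ 1}, …, a_{σ m})`, i.e. `relabel σ z = z · σ⁻¹` for the
customary right action. -/
structure SymmOperad where
  Op : ℕ → Type w
  relabel : ∀ {m n : ℕ}, (Fin m ≃ Fin n) → Op m → Op n
  relabel_refl : ∀ {n : ℕ} (z : Op n), relabel (Equiv.refl _) z = z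
  relabel_trans : ∀ {l m n : ℕ} (σ : Fin l ≃ Fin m) (τ : Fin m ≃ Fin n) (z : Op l),
    relabel τ (relabel σ z) = relabel (σ.trans τ) z
  unit : Op 1
  comp : ∀ {m : ℕ} {n : Fin m → ℕ}, Op m → (∀ i, Op (n i)) → Op (∑ i, n i)
  unit_comp : ∀ {n : ℕ} (x : Op n), relabel (unitLeftEquiv n) (comp unit fun _ => x) = x
  comp_unit : ∀ {m : ℕ} (z : Op m), relabel (unitRightEquiv m) (comp z fun _ => unit) = z
  assoc : ∀ {m : ℕ} {n : Fin m → ℕ} {p : ∀ i, Fin (n i) → ℕ} (z : Op m) (x : ∀ i, Op (n i))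
    (y : ∀ i j, Op (p i j)),
    relabel (assocEquiv p)
      (comp (comp z x) fun k => y (finSigmaFinEquiv.symm k).1 (finSigmaFinEquiv.symm k).2) =
      comp z fun i => comp (x i) (y i)
  comp_relabel : ∀ {m : ℕ} {n n' : Fin m → ℕ} (σ : ∀ i, Fin (n i) ≃ Fin (n' i)) (z : Op m)
    (x : ∀ i, Op (n i)),
    relabel (blockSum σ) (comp z x) = comp z fun i => relabel (σ i) (x i)
  relabel_comp : ∀ {m m' : ℕ} {n : Fin m' → ℕ} (σ : Fin m ≃ Fin m') (z : Op m)
    (x : ∀ i, Op (n i)),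
    relabel (blockPerm n σ) (comp z fun i => x (σ i)) = comp (relabel σ z) x

/-! ### `O`-monoidal categories -/

/-- Concatenation of a family of tuples, in lexicographic order. -/
abbrev flat {A : Type*} {m : ℕ} {n : Fin m → ℕ} (X : ∀ i, Fin (n i) → A) : Fin (∑ i, n i) → A :=
  fun k => X (finSigmaFinEquiv.symm k).1 (finSigmaFinEquiv.symm k).2

lemma flat_apply {A : Type*} {m : ℕ} {n : Fin m → ℕ} (X : ∀ i, Fin (n i) → A)
    (s : Σ i, Fin (n i)) : flat X (finSigmaFinEquiv s) = X s.1 s.2 :=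
  congrArg (fun t : Σ i, Fin (n i) => X t.1 t.2) (Equiv.symm_apply_apply _ s)

lemma flat_blockSum {A : Type*} {m : ℕ} {n n' : Fin m → ℕ} (σ : ∀ i, Fin (n i) ≃ Fin (n' i))
    (X : ∀ i, Fin (n' i) → A) :
    flat (fun i j => X i (σ i j)) = fun k => flat X (blockSum σ k) := by
  funext k
  exact (flat_apply X (Equiv.sigmaCongrRight σ (finSigmaFinEquiv.symm k))).symm

lemma flat_blockPerm {A : Type*} {m m' : ℕ} {n : Fin m' → ℕ} (σ : Fin m ≃ Fin m')
    (X : ∀ i, Fin (n i) → A) :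
    flat (fun i => X (σ i)) = fun k => flat X (blockPerm n σ k) := by
  funext k
  exact (flat_apply X (Equiv.sigmaCongrLeft (β := fun i => Fin (n i)) σ
    (finSigmaFinEquiv.symm k))).symm

lemma flat_assocEquiv {A : Type*} {m : ℕ} {n : Fin m → ℕ} {p : ∀ i, Fin (n i) → ℕ}
    (X : ∀ i j, Fin (p i j) → A) :
    flat (fun k : Fin (∑ i, n i) =>
      X (finSigmaFinEquiv.symm k).1 (finSigmaFinEquiv.symm k).2) =
      fun k => flat (fun i => flat (X i)) (assocEquiv p k) := by
  funext k
  refine Eq.trans ?_ (flat_apply (fun i => flat (X i)) ⟨_, finSigmaFinEquiv ⟨_, _⟩⟩).symm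
  exact (flat_apply (X (finSigmaFinEquiv.symm (finSigmaFinEquiv.symm k).1).1)
    ⟨(finSigmaFinEquiv.symm (finSigmaFinEquiv.symm k).1).2, (finSigmaFinEquiv.symm k).2⟩).symm

/-- An `O`-monoidal category: an operation `tensor z : Cⁿ ⥤ C` for every `z ∈ O(n)`, and natural
isomorphisms comparing these with the symmetric group actions and with the composition of `O`,
such that the operation of the operadic unit is the identity and the isomorphisms are
compatible with the identities that hold in `O`. -/
class OMonoidalCategory (O : SymmOperad.{w}) (C : Type u) [Category.{v} C] where
  tensor : ∀ {n : ℕ}, O.Op n → (Fin n → C) ⥤ C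
  permIso : ∀ {m n : ℕ} (σ : Fin m ≃ Fin n) (z : O.Op m) (X : Fin n → C),
    (tensor z).obj (fun i => X (σ i)) ≅ (tensor (O.relabel σ z)).obj X
  permIso_naturality : ∀ {m n : ℕ} (σ : Fin m ≃ Fin n) (z : O.Op m) {X Y : Fin n → C}
    (f : ∀ i, X i ⟶ Y i),
    (tensor z).map (X := fun i => X (σ i)) (Y := fun i => Y (σ i)) (fun i => f (σ i)) ≫
      (permIso σ z Y).hom = (permIso σ z X).hom ≫ (tensor (O.relabel σ z)).map f
  compIso : ∀ {m : ℕ} {n : Fin m → ℕ} (z : O.Op m) (x : ∀ i, O.Op (n i))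
    (X : ∀ i, Fin (n i) → C),
    (tensor z).obj (fun i => (tensor (x i)).obj (X i)) ≅ (tensor (O.comp z x)).obj (flat X)
  compIso_naturality : ∀ {m : ℕ} {n : Fin m → ℕ} (z : O.Op m) (x : ∀ i, O.Op (n i))
    {X Y : ∀ i, Fin (n i) → C} (f : ∀ i j, X i j ⟶ Y i j),
    (tensor z).map (X := fun i => (tensor (x i)).obj (X i))
        (Y := fun i => (tensor (x i)).obj (Y i)) (fun i => (tensor (x i)).map (f i)) ≫
      (compIso z x Y).hom =
    (compIso z x X).hom ≫ (tensor (O.comp z x)).map (X := flat X) (Y := flat Y)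
      (fun k => f (finSigmaFinEquiv.symm k).1 (finSigmaFinEquiv.symm k).2)
  tensor_unit : tensor O.unit = Pi.eval (fun _ => C) 0
  permIso_refl : ∀ {n : ℕ} (z : O.Op n) (X : Fin n → C),
    (permIso (Equiv.refl _) z X).hom =
      eqToHom (congrArg (fun y => (tensor y).obj X) (O.relabel_refl z).symm)
  permIso_trans : ∀ {l m n : ℕ} (σ : Fin l ≃ Fin m) (τ : Fin m ≃ Fin n) (z : O.Op l)
    (X : Fin n → C),
    (permIso σ z (fun i => X (τ i))).hom ≫ (permIso τ (O.relabel σ z) X).hom =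
      (permIso (σ.trans τ) z X).hom ≫
        eqToHom (congrArg (fun y => (tensor y).obj X) (O.relabel_trans σ τ z).symm)
  compIso_unit_left : ∀ {n : ℕ} (x : O.Op n) (X : Fin n → C),
    (compIso O.unit (fun _ => x) (fun _ => X)).hom ≫
        (permIso (unitLeftEquiv n) (O.comp O.unit fun _ => x) X).hom ≫
        eqToHom (congrArg (fun y => (tensor y).obj X) (O.unit_comp x)) =
      eqToHom (congrArg (fun T => T.obj (fun _ => (tensor x).obj X)) tensor_unit)
  compIso_unit_right : ∀ {m : ℕ} (z : O.Op m) (X : Fin m → C),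
    (compIso z (fun _ => O.unit) (fun i _ => X i)).hom ≫
        (permIso (unitRightEquiv m) (O.comp z fun _ => O.unit) X).hom ≫
        eqToHom (congrArg (fun y => (tensor y).obj X) (O.comp_unit z)) =
      eqToHom (congrArg (tensor z).obj
        (funext fun i => congrArg (fun T => T.obj (fun _ => X i)) tensor_unit))
  compIso_assoc : ∀ {m : ℕ} {n : Fin m → ℕ} {p : ∀ i, Fin (n i) → ℕ} (z : O.Op m)
    (x : ∀ i, O.Op (n i)) (y : ∀ i j, O.Op (p i j)) (X : ∀ i j, Fin (p i j) → C),
    (compIso z x (fun i j => (tensor (y i j)).obj (X i j))).hom ≫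
        (compIso (O.comp z x)
          (fun k => y (finSigmaFinEquiv.symm k).1 (finSigmaFinEquiv.symm k).2)
          (fun k => X (finSigmaFinEquiv.symm k).1 (finSigmaFinEquiv.symm k).2)).hom ≫
        eqToHom (congrArg (tensor _).obj (flat_assocEquiv X)) ≫
        (permIso (assocEquiv p) _ (flat fun i => flat (X i))).hom ≫
        eqToHom (congrArg (fun t => (tensor t).obj (flat fun i => flat (X i)))
          (O.assoc z x y)) =
      (tensor z).map (X := fun i => (tensor (x i)).obj fun j => (tensor (y i j)).obj (X i j))
          (Y := fun i => (tensor (O.comp (x i) (y i))).obj (flat (X i)))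
          (fun i => (compIso (x i) (y i) (X i)).hom) ≫
        (compIso z (fun i => O.comp (x i) (y i)) (fun i => flat (X i))).hom
  compIso_permIso : ∀ {m : ℕ} {n n' : Fin m → ℕ} (σ : ∀ i, Fin (n i) ≃ Fin (n' i))
    (z : O.Op m) (x : ∀ i, O.Op (n i)) (X : ∀ i, Fin (n' i) → C),
    (compIso z x (fun i j => X i (σ i j))).hom ≫
        eqToHom (congrArg (tensor _).obj (flat_blockSum σ X)) ≫
        (permIso (blockSum σ) (O.comp z x) (flat X)).hom ≫
        eqToHom (congrArg (fun t => (tensor t).obj (flat X)) (O.comp_relabel σ z x)) =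
      (tensor z).map (X := fun i => (tensor (x i)).obj fun j => X i (σ i j))
          (Y := fun i => (tensor (O.relabel (σ i) (x i))).obj (X i))
          (fun i => (permIso (σ i) (x i) (X i)).hom) ≫
        (compIso z (fun i => O.relabel (σ i) (x i)) X).hom
  permIso_compIso : ∀ {m m' : ℕ} {n : Fin m' → ℕ} (σ : Fin m ≃ Fin m') (z : O.Op m)
    (x : ∀ i, O.Op (n i)) (X : ∀ i, Fin (n i) → C),
    (compIso z (fun i => x (σ i)) (fun i => X (σ i))).hom ≫
        eqToHom (congrArg (tensor _).obj (flat_blockPerm σ X)) ≫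
        (permIso (blockPerm n σ) (O.comp z fun i => x (σ i)) (flat X)).hom ≫
        eqToHom (congrArg (fun t => (tensor t).obj (flat X)) (O.relabel_comp σ z x)) =
      (permIso σ z (fun i => (tensor (x i)).obj (X i))).hom ≫
        (compIso (O.relabel σ z) x X).hom

/-! ### Lax `O`-monoidal functors -/

section Lax

variable (O : SymmOperad.{w}) {C : Type u₁} [Category.{v₁} C] [OMonoidalCategory O C]
  {D : Type u₂} [Category.{v₂} D] [OMonoidalCategory O D]

open OMonoidalCategory

/-- The axioms on the structure maps `ξ` of a lax `O`-monoidal functor. -/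
structure IsLax (F : C ⥤ D)
    (ξ : ∀ {n : ℕ} (z : O.Op n) (X : Fin n → C),
      (tensor z).obj (fun i => F.obj (X i)) ⟶ F.obj ((tensor z).obj X)) : Prop where
  naturality : ∀ {n : ℕ} (z : O.Op n) {X Y : Fin n → C} (f : ∀ i, X i ⟶ Y i),
    (tensor z).map (X := fun i => F.obj (X i)) (Y := fun i => F.obj (Y i))
        (fun i => F.map (f i)) ≫ ξ z Y =
      ξ z X ≫ F.map ((tensor z).map f)
  unit : ∀ X : Fin 1 → C, ξ O.unit X =
    eqToHom ((congrArg (fun T => T.obj (fun i => F.obj (X i))) (tensor_unit (O := O))).trans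
      (congrArg (fun T => F.obj (T.obj X)) (tensor_unit (O := O)).symm))
  perm : ∀ {m n : ℕ} (σ : Fin m ≃ Fin n) (z : O.Op m) (X : Fin n → C),
    ξ z (fun i => X (σ i)) ≫ F.map (permIso σ z X).hom =
      (permIso σ z (fun i => F.obj (X i))).hom ≫ ξ (O.relabel σ z) X
  comp : ∀ {m : ℕ} {n : Fin m → ℕ} (z : O.Op m) (x : ∀ i, O.Op (n i))
    (X : ∀ i, Fin (n i) → C),
    (tensor z).map (X := fun i => (tensor (x i)).obj fun j => F.obj (X i j))
        (Y := fun i => F.obj ((tensor (x i)).obj (X i))) (fun i => ξ (x i) (X i)) ≫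
        ξ z (fun i => (tensor (x i)).obj (X i)) ≫ F.map (compIso z x X).hom =
      (compIso z x (fun i j => F.obj (X i j))).hom ≫ ξ (O.comp z x) (flat X)

variable (C D) in
/-- A lax `O`-monoidal functor. -/
structure LaxOFunctor where
  toFunctor : C ⥤ D
  ξ : ∀ {n : ℕ} (z : O.Op n) (X : Fin n → C),
    (tensor z).obj (fun i => toFunctor.obj (X i)) ⟶ toFunctor.obj ((tensor z).obj X)
  isLax : IsLax O toFunctor ξ

variable {O} in
/-- `O`-monoidal transformations. -/
@[ext]
structure LaxOFunctor.Hom (F G : LaxOFunctor O C D) where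
  toNatTrans : F.toFunctor ⟶ G.toFunctor
  comm : ∀ {n : ℕ} (z : O.Op n) (X : Fin n → C),
    (tensor z).map (X := fun i => F.toFunctor.obj (X i)) (Y := fun i => G.toFunctor.obj (X i))
        (fun i => toNatTrans.app (X i)) ≫ G.ξ z X =
      F.ξ z X ≫ toNatTrans.app ((tensor z).obj X)

/-- The category of lax `O`-monoidal functors and `O`-monoidal transformations. -/
instance : Category (LaxOFunctor O C D) where
  Hom := LaxOFunctor.Hom
  id F := ⟨𝟙 _, fun z X => by
    have h := (tensor (C := D) z).map_id (fun i => F.toFunctor.obj (X i))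
    simp only [NatTrans.id_app, Category.comp_id]
    refine Eq.trans ?_ (Category.id_comp _)
    exact congrArg (fun t => t ≫ F.ξ z X) h⟩
  comp {F G H} α β := ⟨α.toNatTrans ≫ β.toNatTrans, fun z X => by
    have h := (tensor (C := D) z).map_comp (X := fun i => F.toFunctor.obj (X i))
      (Y := fun i => G.toFunctor.obj (X i)) (Z := fun i => H.toFunctor.obj (X i))
      (fun i => α.toNatTrans.app (X i)) (fun i => β.toNatTrans.app (X i))
    refine (congrArg (fun t => t ≫ H.ξ z X) h).trans ?_
    rw [Category.assoc, β.comm, ← Category.assoc, α.comm, Category.assoc]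
    rfl⟩
  id_comp _ := LaxOFunctor.Hom.ext (Category.id_comp _)
  comp_id _ := LaxOFunctor.Hom.ext (Category.comp_id _)
  assoc _ _ _ := LaxOFunctor.Hom.ext (Category.assoc _ _ _)

/-- A functor is a strict `O`-monoidal functor if it commutes with the operations on the nose
and the resulting identity maps satisfy the axioms of a lax `O`-monoidal functor. -/
def IsStrict (F : C ⥤ D) : Prop :=
  ∃ h : ∀ {n : ℕ} (z : O.Op n) (X : Fin n → C),
    (tensor z).obj (fun i => F.obj (X i)) = F.obj ((tensor z).obj X),
    IsLax O F (fun z X => eqToHom (h z X))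

end Lax

/-! ### Convex sets and their tensor products -/

section Convexity

open Convexity

/-- The category `CSet` of convex sets: algebras over the monad of finitely supported
probability distributions with weights in `ℝ≥0`. -/
structure CSet : Type (u + 1) where
  carrier : Type u
  [convex : ConvexSpace ℝ≥0 carrier]

instance : CoeSort CSet.{u} (Type u) := ⟨CSet.carrier⟩

instance (X : CSet.{u}) : ConvexSpace ℝ≥0 X := X.convex

instance : LargeCategory CSet.{u} where
  Hom X Y := ConvexSpace.AffineMap ℝ≥0 X Y
  id X := ConvexSpace.AffineMap.id X
  comp f g := ConvexSpace.AffineMap.comp g f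

namespace CSet

/-- A morphism of `CSet` from a convex map. -/
def ofFun {X Y : CSet.{u}} (f : X → Y) (hf : IsAffineMap ℝ≥0 f) : X ⟶ Y := ⟨f, hf⟩

/-- The convex map underlying a morphism of `CSet`. -/
def toFun {X Y : CSet.{u}} (f : X ⟶ Y) : X → Y := ConvexSpace.AffineMap.toFun f

lemma toFun_affine {X Y : CSet.{u}} (f : X ⟶ Y) : IsAffineMap ℝ≥0 (toFun f) :=
  ConvexSpace.AffineMap.isAffineMap_toFun f

@[simp] lemma toFun_ofFun {X Y : CSet.{u}} (f : X → Y) (hf : IsAffineMap ℝ≥0 f) :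
    toFun (ofFun f hf) = f := rfl

@[simp] lemma toFun_id (X : CSet.{u}) : toFun (𝟙 X) = id := rfl

@[simp] lemma toFun_comp {X Y Z : CSet.{u}} (f : X ⟶ Y) (g : Y ⟶ Z) (x : X) :
    toFun (f ≫ g) x = toFun g (toFun f x) := rfl

lemma hom_ext {X Y : CSet.{u}} {f g : X ⟶ Y} (h : ∀ x, toFun f x = toFun g x) : f = g :=
  ConvexSpace.AffineMap.ext (funext h)

/-- The forgetful functor from convex sets to sets. -/
def forget : CSet.{u} ⥤ Type u where
  obj X := X
  map f := TypeCat.ofHom (toFun f)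

end CSet

/-- `n`-convex maps: maps that are convex in every variable separately. -/
def MultiConvex {ι : Type*} [DecidableEq ι] {A : ι → Type*} [∀ i, ConvexSpace ℝ≥0 (A i)]
    {Z : Type*} [ConvexSpace ℝ≥0 Z] (f : (∀ i, A i) → Z) : Prop :=
  ∀ (i : ι) (x : ∀ i, A i), IsAffineMap ℝ≥0 (fun a : A i => f (Function.update x i a))

/-- Convex equivalence relations: convex combinations of related elements are related. -/
structure IsConvexEquiv {X : Type u} [ConvexSpace ℝ≥0 X] (r : X → X → Prop) : Prop where
  equiv : Equivalence r
  convex : ∀ {J : Type u} (p : StdSimplex ℝ≥0 J) (x y : J → X), (∀ j, r (x j) (y j)) →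
    r (p.iConvexComb x) (p.iConvexComb y)

/-- The convex closure of a relation, i.e. the least convex equivalence relation
containing it. -/
def convexClosure {X : Type u} [ConvexSpace ℝ≥0 X] (g : X → X → Prop) (x y : X) : Prop :=
  ∀ r : X → X → Prop, IsConvexEquiv r → (∀ a b, g a b → r a b) → r x y

lemma convexClosure_isConvexEquiv {X : Type u} [ConvexSpace ℝ≥0 X] (g : X → X → Prop) :
    IsConvexEquiv (convexClosure g) where
  equiv :=
    { refl := fun x _ hr _ => hr.equiv.refl x
      symm := fun h r hr hg => hr.equiv.symm (h r hr hg)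
      trans := fun h h' r hr hg => hr.equiv.trans (h r hr hg) (h' r hr hg) }
  convex := fun p x y h r hr hg => hr.convex p x y fun j => h j r hr hg

/-- The quotient of a convex set by the convex closure of a relation. -/
def ConvexQuot {X : Type u} [ConvexSpace ℝ≥0 X] (g : X → X → Prop) : Type u :=
  Quotient ⟨convexClosure g, (convexClosure_isConvexEquiv g).equiv⟩

namespace ConvexQuot

variable {X : Type u} [ConvexSpace ℝ≥0 X] (g : X → X → Prop)

/-- The quotient map. -/
def mk (x : X) : ConvexQuot g :=
  Quotient.mk ⟨convexClosure g, (convexClosure_isConvexEquiv g).equiv⟩ x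

/-- A chosen representative. -/
noncomputable def out (q : ConvexQuot g) : X := Quotient.out q

lemma mk_out (q : ConvexQuot g) : mk g (out g q) = q := Quotient.out_eq q

lemma mk_eq {x y : X} : mk g x = mk g y ↔ convexClosure g x y := Quotient.eq

lemma mk_comb (p : StdSimplex ℝ≥0 X) :
    mk g ((p.map (mk g)).iConvexComb (out g)) = mk g p.sConvexComb := by
  rw [iConvexComb_map, ← iConvexComb_id', mk_eq]
  exact (convexClosure_isConvexEquiv g).convex p _ _ fun x => (mk_eq g).1 (mk_out g _)

/-- Convex combinations in the quotient are computed on representatives. -/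
noncomputable instance : ConvexSpace ℝ≥0 (ConvexQuot g) :=
  ConvexSpace.mk (fun P => mk g (P.iConvexComb (out g)))
    (fun q => by rw [iConvexComb_single, mk_out])
    (fun f => by
      have h : f.map (fun P : StdSimplex ℝ≥0 (ConvexQuot g) =>
          mk g (P.iConvexComb (out g))) =
          (f.map fun P : StdSimplex ℝ≥0 (ConvexQuot g) => P.iConvexComb (out g)).map
            (mk g) := by rw [StdSimplex.map_map]
      rw [h, mk_comb]
      congr 1
      exact iConvexComb_assoc f (fun P => P) (out g) |>.trans (by simp))

lemma mk_affine : IsAffineMap ℝ≥0 (mk g) := ⟨fun p => (mk_comb g p).symm⟩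

lemma lift_aux {Z : Type v} [ConvexSpace ℝ≥0 Z] (f : X → Z) (hf : IsAffineMap ℝ≥0 f)
    (h : ∀ a b, g a b → f a = f b) (x y : X) (hxy : convexClosure g x y) : f x = f y :=
  hxy (fun a b => f a = f b)
    { equiv := ⟨fun _ => rfl, fun h => h.symm, fun h h' => h.trans h'⟩
      convex := fun p x y h => by
        rw [hf.map_iConvexComb, hf.map_iConvexComb]
        exact congrArg _ (funext h) } h

/-- Descent of a convex map to the quotient. -/
def lift {Z : Type v} [ConvexSpace ℝ≥0 Z] (f : X → Z) (hf : IsAffineMap ℝ≥0 f)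
    (h : ∀ a b, g a b → f a = f b) : ConvexQuot g → Z :=
  Quotient.lift f (lift_aux g f hf h)

lemma lift_affine {Z : Type v} [ConvexSpace ℝ≥0 Z] (f : X → Z) (hf : IsAffineMap ℝ≥0 f)
    (h : ∀ a b, g a b → f a = f b) : IsAffineMap ℝ≥0 (lift g f hf h) := ⟨fun P => by
  change f (P.iConvexComb (out g)) = _
  rw [hf.map_iConvexComb]
  refine congrArg (fun t => P.iConvexComb t) (funext fun q => ?_)
  induction q using Quotient.inductionOn with
  | h x => exact lift_aux g f hf h _ _ ((mk_eq g).1 (mk_out g (mk g x)))⟩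

end ConvexQuot

/-- The generating relation of the tensor product: in each variable, the tuple whose `i`-th entry
is a convex combination `∑ⱼ αⱼ aⱼ` is identified with the formal convex combination, with the
same weights, of the tuples with `i`-th entry `aⱼ`. -/
inductive TensorRel {n : ℕ} (X : Fin n → CSet.{u}) :
    StdSimplex ℝ≥0 (∀ i, X i) → StdSimplex ℝ≥0 (∀ i, X i) → Prop
  | mk (i : Fin n) (x : ∀ i, X i) (p : StdSimplex ℝ≥0 (X i)) :
    TensorRel X (StdSimplex.single (Function.update x i p.sConvexComb))
      (p.map fun a => Function.update x i a)

/-- The `n`-fold convex tensor product of convex sets: the quotient of the free convex set on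
their cartesian product by the convex closure of the multilinearity relation. The `1`-fold tensor
product of `X` is taken to be `X` itself. -/
noncomputable def tensorObj : ∀ {n : ℕ}, (Fin n → CSet.{u}) → CSet.{u}
  | 0, X => ⟨ConvexQuot (TensorRel X)⟩
  | 1, X => X 0
  | _ + 2, X => ⟨ConvexQuot (TensorRel X)⟩

/-- Pure tensors. -/
noncomputable def pure : ∀ {n : ℕ} {X : Fin n → CSet.{u}}, (∀ i, X i) → tensorObj X
  | 0, X, x => ConvexQuot.mk (TensorRel X) (StdSimplex.single x)
  | 1, _, x => x 0
  | _ + 2, X, x => ConvexQuot.mk (TensorRel X) (StdSimplex.single x)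

section Quot

variable {n : ℕ} (X : Fin n → CSet.{u})

lemma quot_multi : MultiConvex fun x : ∀ i, X i =>
    ConvexQuot.mk (TensorRel X) (StdSimplex.single x) := fun i x => ⟨fun p => by
  have h : ConvexQuot.mk (TensorRel X) (StdSimplex.single (Function.update x i p.sConvexComb)) =
      ConvexQuot.mk (TensorRel X) (p.map fun a => Function.update x i a) :=
    (ConvexQuot.mk_eq _).2 fun r _ hg => hg _ _ (TensorRel.mk i x p)
  refine h.trans ?_
  have h2 : p.map (fun a => Function.update x i a) =
      (p.map fun a => StdSimplex.single (Function.update x i a)).sConvexComb := by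
    have h3 : ∀ q : StdSimplex ℝ≥0 (∀ i, X i),
        (q.map fun a => StdSimplex.single (R := ℝ≥0) a).sConvexComb = q := fun q => by
      ext1
      simp [Finsupp.sum_mapDomain_index, add_smul]
    rw [← h3 (p.map _), StdSimplex.map_map]
  rw [h2, (ConvexQuot.mk_affine (TensorRel X)).map_sConvexComb, StdSimplex.map_map]⟩

lemma comb_affine {J : Type u} {Z : Type v} [ConvexSpace ℝ≥0 Z] (f : J → Z) :
    IsAffineMap ℝ≥0 fun p : StdSimplex ℝ≥0 J => p.iConvexComb f := ⟨fun P => by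
  have h := iConvexComb_assoc P (fun p => p) f
  rw [iConvexComb_id'] at h
  exact h.symm⟩

lemma quot_desc {Z : Type v} [ConvexSpace ℝ≥0 Z] (f : (∀ i, X i) → Z) (hf : MultiConvex f) :
    ∃ h : ConvexQuot (TensorRel X) → Z, IsAffineMap ℝ≥0 h ∧
      ∀ x, h (ConvexQuot.mk _ (StdSimplex.single x)) = f x :=
  ⟨ConvexQuot.lift _ (fun p => p.iConvexComb f) (comb_affine f) (by
      rintro _ _ ⟨i, x, p⟩
      rw [iConvexComb_single, iConvexComb_map]
      exact (hf i x).map_sConvexComb p), ConvexQuot.lift_affine _ _ _ _,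
    fun x => iConvexComb_single x f⟩

lemma quot_ext {Z : Type v} [ConvexSpace ℝ≥0 Z] {h h' : ConvexQuot (TensorRel X) → Z}
    (hh : IsAffineMap ℝ≥0 h) (hh' : IsAffineMap ℝ≥0 h')
    (H : ∀ x, h (ConvexQuot.mk _ (StdSimplex.single x)) =
      h' (ConvexQuot.mk _ (StdSimplex.single x))) : h = h' := by
  funext q
  induction q using Quotient.inductionOn with
  | h p =>
    have h3 : ((p.map fun a => StdSimplex.single (R := ℝ≥0) a)).sConvexComb = p := by
      ext1
      simp [Finsupp.sum_mapDomain_index, add_smul]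
    have key : ∀ k : ConvexQuot (TensorRel X) → Z, IsAffineMap ℝ≥0 k →
        k (ConvexQuot.mk _ p) =
          p.iConvexComb fun x => k (ConvexQuot.mk _ (StdSimplex.single x)) := fun k hk => by
      conv_lhs => rw [← h3]
      refine ((hk.comp (ConvexQuot.mk_affine (TensorRel X))).map_sConvexComb _).trans ?_
      rw [StdSimplex.map_map]
      rfl
    exact (key h hh).trans ((congrArg _ (funext H)).trans (key h' hh').symm)

end Quot

/-- The universal property of the tensor product, existence. -/
lemma exists_desc : ∀ {n : ℕ} {X : Fin n → CSet.{u}} {Z : Type v} [ConvexSpace ℝ≥0 Z]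
    (f : (∀ i, X i) → Z), MultiConvex f →
    ∃ h : tensorObj X → Z, IsAffineMap ℝ≥0 h ∧ ∀ x : ∀ i, X i, h (pure x) = f x
  | 0, X, _, _, f, hf => quot_desc X f hf
  | 1, X, _, _, f, hf => by
    refine ⟨fun a => f ((Equiv.piUnique fun i => (X i : Type u)).symm a), ?_, fun x => ?_⟩
    · have h := hf 0
      by_cases hne : Nonempty (∀ i, X i)
      · obtain ⟨x⟩ := hne
        have e : (fun a : X 0 => f ((Equiv.piUnique fun i => (X i : Type u)).symm a)) =
            fun a => f (Function.update x 0 a) := funext fun a =>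
          congrArg f ((Equiv.symm_apply_eq (Equiv.piUnique fun i => (X i : Type u))).2
            (Function.update_self (β := fun i => (X i : Type u)) 0 a x).symm)
        exact (congrArg (IsAffineMap ℝ≥0) e).mpr (h x)
      · exact ⟨fun p => (hne ⟨(Equiv.piUnique fun i => (X i : Type u)).symm p.sConvexComb⟩).elim⟩
    · exact congrArg f ((Equiv.piUnique fun i => (X i : Type u)).symm_apply_apply x)
  | _ + 2, X, _, _, f, hf => quot_desc X f hf

/-- The universal property of the tensor product, uniqueness. -/
lemma desc_unique : ∀ {n : ℕ} {X : Fin n → CSet.{u}} {Z : Type v} [ConvexSpace ℝ≥0 Z]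
    {h h' : tensorObj X → Z}, IsAffineMap ℝ≥0 h → IsAffineMap ℝ≥0 h' →
    (∀ x : ∀ i, X i, h (pure x) = h' (pure x)) → h = h'
  | 0, X, _, _, _, _, hh, hh', H => quot_ext X hh hh' H
  | 1, X, _, _, h, h', _, _, H => funext fun a => by
    have := H ((Equiv.piUnique fun i => (X i : Type u)).symm a)
    have e : pure ((Equiv.piUnique fun i => (X i : Type u)).symm a) = a :=
      (Equiv.piUnique fun i => (X i : Type u)).apply_symm_apply a
    rwa [e] at this
  | _ + 2, X, _, _, _, _, hh, hh', H => quot_ext X hh hh' H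

lemma pure_multi : ∀ {n : ℕ} {X : Fin n → CSet.{u}},
    MultiConvex (fun x : ∀ i, X i => pure x)
  | 0, X => quot_multi X
  | 1, X => fun i x => by
    obtain rfl := Subsingleton.elim i 0
    have e : (fun a : X 0 => Function.update x 0 a 0) = id := funext fun a =>
      Function.update_self (β := fun i => (X i : Type u)) 0 a x
    exact (congrArg (IsAffineMap ℝ≥0) e).mpr IsAffineMap.id
  | _ + 2, X => quot_multi X

end Convexity

section TensorStructure

open Convexity

namespace MultiConvex

lemma piCongrLeft_comp {ι κ : Type*} (e : ι ≃ κ) (A : κ → Type*) (x : ∀ k, A k) :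
    Equiv.piCongrLeft A e (fun i => x (e i)) = x := by
  funext k
  obtain ⟨i, rfl⟩ := e.surjective k
  exact Equiv.piCongrLeft_apply_apply A e _ i

variable {ι : Type*} [DecidableEq ι] {κ : Type*} [DecidableEq κ]

lemma affine_comp {A : ι → Type*} [∀ i, ConvexSpace ℝ≥0 (A i)] {Z W : Type*}
    [ConvexSpace ℝ≥0 Z] [ConvexSpace ℝ≥0 W] {f : (∀ i, A i) → Z} (hf : MultiConvex f)
    {h : Z → W} (hh : IsAffineMap ℝ≥0 h) : MultiConvex (fun x => h (f x)) :=
  fun i x => hh.comp (hf i x)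

lemma comp_affine {A B : ι → Type*} [∀ i, ConvexSpace ℝ≥0 (A i)]
    [∀ i, ConvexSpace ℝ≥0 (B i)] {Z : Type*}
    [ConvexSpace ℝ≥0 Z] {f : (∀ i, B i) → Z} (hf : MultiConvex f)
    {g : ∀ i, A i → B i} (hg : ∀ i, IsAffineMap ℝ≥0 (g i)) :
    MultiConvex (fun x : ∀ i, A i => f fun i => g i (x i)) := fun i x => by
  have e : (fun a => f fun j => g j (Function.update x i a j)) =
      (fun b => f (Function.update (fun j => g j (x j)) i b)) ∘ g i := by
    funext a
    exact congrArg f (funext fun j => Function.apply_update (fun j => g j) x i a j)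
  exact (congrArg (IsAffineMap ℝ≥0) e).mpr ((hf i _).comp (hg i))

lemma reindex (e : ι ≃ κ) {A : κ → Type*} [∀ k, ConvexSpace ℝ≥0 (A k)] {Z : Type*}
    [ConvexSpace ℝ≥0 Z] {f : (∀ i, A (e i)) → Z} (hf : MultiConvex f) :
    MultiConvex (fun x : ∀ k, A k => f fun i => x (e i)) := fun k x => by
  obtain ⟨i, rfl⟩ := e.surjective k
  have h : (fun a => f fun j => Function.update x (e i) a (e j)) =
      fun a => f (Function.update (fun j => x (e j)) i a) := funext fun a =>
    congrArg f (Function.update_comp_eq_of_injective' x e.injective i a)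
  exact (congrArg (IsAffineMap ℝ≥0) h).mpr (hf i _)

lemma reindex' (e : ι ≃ κ) {A : κ → Type*} [∀ k, ConvexSpace ℝ≥0 (A k)] {Z : Type*}
    [ConvexSpace ℝ≥0 Z] {f : (∀ k, A k) → Z} (hf : MultiConvex f) :
    MultiConvex (fun y : ∀ i, A (e i) => f (Equiv.piCongrLeft A e y)) := fun i y => by
  have h : (fun a => f (Equiv.piCongrLeft A e (Function.update y i a))) =
      fun a => f (Function.update (Equiv.piCongrLeft A e y) (e i) a) := funext fun a => by
    have h2 := Function.update_comp_eq_of_injective' (Equiv.piCongrLeft A e y) e.injective i a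
    rw [← piCongrLeft_comp e A (Function.update (Equiv.piCongrLeft A e y) (e i) a), h2]
    congr 3
    funext j
    exact (Equiv.piCongrLeft_apply_apply A e y j).symm
  exact (congrArg (IsAffineMap ℝ≥0) h).mpr (hf (e i) _)

lemma iConvexComb {A : ι → Type*} [∀ i, ConvexSpace ℝ≥0 (A i)] {Z : Type*}
    [ConvexSpace ℝ≥0 Z] {J : Type*} (p : StdSimplex ℝ≥0 J) {f : J → (∀ i, A i) → Z}
    (hf : ∀ j, MultiConvex (f j)) : MultiConvex (fun x => p.iConvexComb fun j => f j x) :=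
  fun i x => ⟨fun s => by
    rw [sConvexComb_map, iConvexComb_comm]
    exact congrArg _ (funext fun j => (hf j i x).map_sConvexComb s)⟩

end MultiConvex

lemma affine_iConvexComb {A Z J : Type*} [ConvexSpace ℝ≥0 A] [ConvexSpace ℝ≥0 Z]
    (p : StdSimplex ℝ≥0 J) {f : J → A → Z} (hf : ∀ j, IsAffineMap ℝ≥0 (f j)) :
    IsAffineMap ℝ≥0 (fun x => p.iConvexComb fun j => f j x) := ⟨fun s => by
  rw [sConvexComb_map, iConvexComb_comm]
  exact congrArg _ (funext fun j => (hf j).map_sConvexComb s)⟩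

lemma multi_unique {m : ℕ} {n : Fin m → ℕ} {X : ∀ i, Fin (n i) → CSet.{u}} {Z : Type v}
    [ConvexSpace ℝ≥0 Z] {g g' : (∀ i, tensorObj (X i)) → Z} (hg : MultiConvex g)
    (hg' : MultiConvex g')
    (H : ∀ x : ∀ i j, X i j, g (fun i => pure (x i)) = g' (fun i => pure (x i))) : g = g' := by
  have key : ∀ (s : Finset (Fin m)) (t : ∀ i, tensorObj (X i)),
      (∀ i, i ∉ s → ∃ x : ∀ j, X i j, t i = pure x) → g t = g' t := by
    intro s
    induction s using Finset.induction_on with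
    | empty =>
      intro t ht
      choose x hx using fun i => ht i (Finset.notMem_empty i)
      have : t = fun i => pure (x i) := funext hx
      rw [this, H]
    | insert i s his ih =>
      intro t ht
      have h := desc_unique (hg i t) (hg' i t) fun x => ih _ fun k hk => by
        by_cases hki : k = i
        · subst hki
          exact ⟨x, Function.update_self (β := fun i => (tensorObj (X i) : Type u)) ..⟩
        · obtain ⟨y, hy⟩ := ht k (by simp [hki, hk])
          exact ⟨y, (Function.update_of_ne (β := fun i => (tensorObj (X i) : Type u)) hki _ _).trans
            hy⟩
      have h2 := congrFun h (t i)
      have e : Function.update t i (t i) = t :=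
        Function.update_eq_self (β := fun i => (tensorObj (X i) : Type u)) i t
      rwa [e] at h2
  exact funext fun t => key Finset.univ t fun i hi => (hi (Finset.mem_univ i)).elim

lemma exists_ext : ∀ {m : ℕ} {n : Fin m → ℕ} (X : ∀ i, Fin (n i) → CSet.{u}) {Z : Type v}
    [ConvexSpace ℝ≥0 Z] (f : (∀ i j, X i j) → Z),
    (∀ (i) (x : ∀ i j, X i j), MultiConvex fun a : ∀ j, X i j => f (Function.update x i a)) →
    ∃ g : (∀ i, tensorObj (X i)) → Z, MultiConvex g ∧
      ∀ x : ∀ i j, X i j, g (fun i => pure (x i)) = f x := by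
  intro m
  induction m with
  | zero =>
    intro n X Z _ f _
    exact ⟨fun _ => f fun i => i.elim0, fun i => i.elim0,
      fun x => congrArg f (funext fun i => i.elim0)⟩
  | succ m ih =>
    intro n X Z _ f hf
    have h1 : ∀ x₀ : ∀ j, X 0 j, ∃ g : (∀ i : Fin m, tensorObj (X i.succ)) → Z, MultiConvex g ∧
        ∀ x : ∀ (i : Fin m) j, X i.succ j, g (fun i => pure (x i)) =
          f (Fin.cons (α := fun i => ∀ j, X i j) x₀ x) := fun x₀ =>
      ih (fun i => X i.succ) (fun x => f (Fin.cons (α := fun i => ∀ j, X i j) x₀ x))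
        fun i x => by
          have e : (fun a => f (Fin.cons (α := fun i => ∀ j, X i j) x₀
              (Function.update x i a))) = fun a => f (Function.update
                (Fin.cons (α := fun i => ∀ j, X i j) x₀ x) i.succ a) := funext fun a =>
            congrArg f (Fin.cons_update (α := fun i => ∀ j, X i j) x₀ x i a)
          exact (congrArg MultiConvex e).mpr (hf i.succ _)
    choose G hG hGf using h1
    have h2 : ∀ t, MultiConvex fun x₀ => G x₀ t := fun t j x₀ => ⟨fun p => by
      have e := multi_unique (hG (Function.update x₀ j p.sConvexComb))
        (MultiConvex.iConvexComb p fun b => hG (Function.update x₀ j b)) fun x => by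
          rw [hGf]
          simp only [hGf]
          have := (hf 0 (Fin.cons (α := fun i => ∀ j, X i j) x₀ x) j x₀).map_sConvexComb p
          rw [sConvexComb_map] at this
          simpa only [Fin.update_cons_zero] using this
      rw [sConvexComb_map]
      exact congrFun e t⟩
    choose H hH hHG using fun t => exists_desc _ (h2 t)
    refine ⟨fun t => H (fun i => t i.succ) (t 0), fun i t => ?_, fun x => ?_⟩
    · induction i using Fin.cases with
      | zero =>
        have e : (fun a => H (fun i => Function.update t 0 a i.succ) (Function.update t 0 a 0)) =
            fun a => H (fun i => t i.succ) a := by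
          funext a
          have e1 : (fun i : Fin m => Function.update t 0 a i.succ) = fun i : Fin m => t i.succ :=
            funext fun i => Function.update_of_ne
              (β := fun i => (tensorObj (X i) : Type u)) (Fin.succ_ne_zero i) _ _
          have e2 : Function.update t 0 a 0 = a :=
            Function.update_self (β := fun i => (tensorObj (X i) : Type u)) ..
          rw [e1, e2]
        exact (congrArg (IsAffineMap ℝ≥0) e).mpr (hH _)
      | succ i =>
        have e : (fun a => H (fun k => Function.update t i.succ a k.succ)
            (Function.update t i.succ a 0)) =
            fun a => H (Function.update (fun k => t k.succ) i a) (t 0) := by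
          funext a
          have e1 : (fun k : Fin m => Function.update t i.succ a k.succ) =
              Function.update (fun k => t k.succ) i a :=
            Function.update_comp_eq_of_injective' (β := fun i => (tensorObj (X i) : Type u)) t
              (Fin.succ_injective m) i a
          have e2 : Function.update t i.succ a 0 = t 0 := Function.update_of_ne
              (β := fun i => (tensorObj (X i) : Type u)) (Fin.succ_ne_zero i).symm _ _
          rw [e1, e2]
        refine (congrArg (IsAffineMap ℝ≥0) e).mpr ⟨fun p => ?_⟩
        have e3 := desc_unique (hH (Function.update (fun k => t k.succ) i p.sConvexComb))
          (affine_iConvexComb p fun a => hH (Function.update (fun k => t k.succ) i a))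
          fun x₀ => by
            simp only [hHG]
            exact (hG x₀ i _).map_sConvexComb p
        exact congrFun e3 (t 0)
    · refine (hHG (fun i : Fin m => pure (x i.succ)) (x 0)).trans ((hGf _ _).trans ?_)
      exact congrArg f (Fin.cons_self_tail (α := fun i => ∀ j, X i j) x)

/-- The morphism out of the tensor product induced by an `n`-convex map. -/
noncomputable def desc {n : ℕ} {X : Fin n → CSet.{u}} {Z : CSet.{u}} (f : (∀ i, X i) → Z)
    (hf : MultiConvex f) : tensorObj X ⟶ Z :=
  CSet.ofFun (exists_desc f hf).choose (exists_desc f hf).choose_spec.1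

@[simp] lemma desc_pure {n : ℕ} {X : Fin n → CSet.{u}} {Z : CSet.{u}} (f : (∀ i, X i) → Z)
    (hf : MultiConvex f) (x : ∀ i, X i) : CSet.toFun (desc f hf) (pure x) = f x :=
  (exists_desc f hf).choose_spec.2 x

lemma tensor_ext {n : ℕ} {X : Fin n → CSet.{u}} {Z : CSet.{u}} {f g : tensorObj X ⟶ Z}
    (h : ∀ x : ∀ i, X i, CSet.toFun f (pure x) = CSet.toFun g (pure x)) : f = g :=
  CSet.hom_ext fun t =>
    congrFun (desc_unique (CSet.toFun_affine f) (CSet.toFun_affine g) h) t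

lemma tensor_ext₂ {m : ℕ} {n : Fin m → ℕ} {X : ∀ i, Fin (n i) → CSet.{u}} {Z : CSet.{u}}
    {f g : tensorObj (fun i => tensorObj (X i)) ⟶ Z}
    (h : ∀ x : ∀ i j, X i j, CSet.toFun f (pure fun i => pure (x i)) =
      CSet.toFun g (pure fun i => pure (x i))) : f = g :=
  tensor_ext fun t => congrFun (multi_unique (pure_multi.affine_comp (CSet.toFun_affine f))
    (pure_multi.affine_comp (CSet.toFun_affine g)) h) t

/-- Functoriality of the tensor product. -/
noncomputable def tensorMap {n : ℕ} {X Y : Fin n → CSet.{u}} (f : ∀ i, X i ⟶ Y i) :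
    tensorObj X ⟶ tensorObj Y :=
  desc (fun x => pure fun i => CSet.toFun (f i) (x i))
    (pure_multi.comp_affine fun i => CSet.toFun_affine (f i))

@[simp] lemma tensorMap_pure {n : ℕ} {X Y : Fin n → CSet.{u}} (f : ∀ i, X i ⟶ Y i)
    (x : ∀ i, X i) :
    CSet.toFun (tensorMap f) (pure x) = pure fun i => CSet.toFun (f i) (x i) :=
  desc_pure _ _ _

/-- The `n`-fold tensor product functor. -/
noncomputable def tensorFunctor (n : ℕ) : (Fin n → CSet.{u}) ⥤ CSet.{u} where
  obj X := tensorObj X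
  map f := tensorMap f
  map_id X := tensor_ext fun x => by
    rw [tensorMap_pure]
    rfl
  map_comp f g := tensor_ext fun x => by
    rw [CSet.toFun_comp, tensorMap_pure, tensorMap_pure, tensorMap_pure]
    rfl

/-- The symmetry: `⊗ᵢ x_{σ i} ↦ ⊗ⱼ xⱼ`. -/
noncomputable def tensorPerm {m n : ℕ} (σ : Fin m ≃ Fin n) (X : Fin n → CSet.{u}) :
    tensorObj (fun i => X (σ i)) ≅ tensorObj X where
  hom := desc (fun y => pure (Equiv.piCongrLeft (fun j => (X j : Type u)) σ y))
    (MultiConvex.reindex' (A := fun j => (X j : Type u)) σ pure_multi)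
  inv := desc (fun x => pure fun i => x (σ i))
    (MultiConvex.reindex (A := fun j => (X j : Type u)) σ pure_multi)
  hom_inv_id := tensor_ext fun y => by
    rw [CSet.toFun_comp, desc_pure, desc_pure]
    exact congrArg pure (funext fun i =>
      Equiv.piCongrLeft_apply_apply (fun j => (X j : Type u)) σ y i)
  inv_hom_id := tensor_ext fun x => by
    rw [CSet.toFun_comp, desc_pure, desc_pure]
    exact congrArg pure (MultiConvex.piCongrLeft_comp σ (fun j => (X j : Type u)) x)

lemma tensorPerm_pure {m n : ℕ} (σ : Fin m ≃ Fin n) (X : Fin n → CSet.{u}) (x : ∀ j, X j) :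
    CSet.toFun (tensorPerm σ X).hom (pure fun i => x (σ i)) = pure x :=
  (desc_pure _ (MultiConvex.reindex' (A := fun j => (X j : Type u)) σ pure_multi) _).trans
    (congrArg pure (MultiConvex.piCongrLeft_comp σ (fun j => (X j : Type u)) x))

lemma exists_reindex {m n : ℕ} (σ : Fin m ≃ Fin n) {X : Fin n → CSet.{u}}
    (y : ∀ i, X (σ i)) : ∃ x : ∀ j, X j, y = fun i => x (σ i) :=
  ⟨Equiv.piCongrLeft (fun j => (X j : Type u)) σ y, funext fun i =>
    (Equiv.piCongrLeft_apply_apply (fun j => (X j : Type u)) σ y i).symm⟩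

section Comp

variable {m : ℕ} {n : Fin m → ℕ} (X : ∀ i, Fin (n i) → CSet.{u})

lemma uncurry_multi {Z : Type*} [ConvexSpace ℝ≥0 Z]
    {P : (∀ s : Σ i, Fin (n i), X s.1 s.2) → Z} (hP : MultiConvex P) (i : Fin m)
    (x : ∀ i j, X i j) :
    MultiConvex fun a : ∀ j, X i j => P fun s => Function.update x i a s.1 s.2 := fun j a => by
  have e : (fun b => P fun s => Function.update x i (Function.update a j b) s.1 s.2) =
      fun b => P (Function.update (β := fun s : Σ i, Fin (n i) => (X s.1 s.2 : Type u))
        (fun s => Function.update x i a s.1 s.2) ⟨i, j⟩ b) := by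
    funext b
    refine congrArg P (funext fun ⟨i', j'⟩ => ?_)
    by_cases hi : i' = i
    · subst hi
      by_cases hj : j' = j
      · subst hj
        simp
      · have : (⟨i', j'⟩ : Σ i, Fin (n i)) ≠ ⟨i', j⟩ := fun h => hj (by simpa using h)
        simp [hj]
    · have : (⟨i', j'⟩ : Σ i, Fin (n i)) ≠ ⟨i, j⟩ := fun h => hi (congrArg Sigma.fst h)
      simp [hi, this]
  exact (congrArg (IsAffineMap ℝ≥0) e).mpr (hP ⟨i, j⟩ _)

lemma pure_pure_multi : MultiConvex fun x : ∀ s : Σ i, Fin (n i), X s.1 s.2 =>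
    (pure fun i => pure fun j => x ⟨i, j⟩ : tensorObj fun i => tensorObj (X i)) :=
  fun ⟨i, j⟩ x => by
    have e : (fun b => (pure fun i' => pure fun j' => Function.update x ⟨i, j⟩ b ⟨i', j'⟩ :
        tensorObj fun i => tensorObj (X i))) =
        (fun t : tensorObj (X i) => (pure (Function.update
          (fun i' => (pure fun j' => x ⟨i', j'⟩ : tensorObj (X i'))) i t) :
            tensorObj fun i => tensorObj (X i))) ∘
        fun b : X i j => (pure (Function.update (fun j' => x ⟨i, j'⟩) j b) : tensorObj (X i)) := by
      funext b
      refine congrArg pure (funext fun i' => ?_)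
      by_cases hi : i' = i
      · subst hi
        refine Eq.trans ?_ (Function.update_self
          (β := fun i => (tensorObj (X i) : Type u)) i' _ _).symm
        refine congrArg pure (funext fun j' => ?_)
        by_cases hj : j' = j
        · subst hj
          simp
        · have : (⟨i', j'⟩ : Σ i, Fin (n i)) ≠ ⟨i', j⟩ := fun h => hj (by simpa using h)
          simp [hj]
      · refine Eq.trans ?_ (Function.update_of_ne
          (β := fun i => (tensorObj (X i) : Type u)) hi _ _).symm
        refine congrArg pure (funext fun j' => ?_)
        have : (⟨i', j'⟩ : Σ i, Fin (n i)) ≠ ⟨i, j⟩ := fun h => hi (congrArg Sigma.fst h)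
        simp [this]
    exact (congrArg (IsAffineMap ℝ≥0) e).mpr ((pure_multi i _).comp (pure_multi j _))

lemma exists_comp : ∃ g : (∀ i, tensorObj (X i)) → tensorObj (flat X), MultiConvex g ∧
    ∀ x : ∀ i j, X i j, g (fun i => pure (x i)) =
      pure fun k => x (finSigmaFinEquiv.symm k).1 (finSigmaFinEquiv.symm k).2 :=
  exists_ext X _ fun i x => uncurry_multi X
    (MultiConvex.reindex (A := fun s : Σ i, Fin (n i) => (X s.1 s.2 : Type u))
      finSigmaFinEquiv.symm (pure_multi (X := flat X))) i x

/-- The map `⊗ᵢ ⊗ⱼ xᵢⱼ ↦ ⊗₍ᵢⱼ₎ xᵢⱼ`. -/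
noncomputable def tensorCompHom : tensorObj (fun i => tensorObj (X i)) ⟶ tensorObj (flat X) :=
  desc (exists_comp X).choose (exists_comp X).choose_spec.1

lemma tensorCompHom_pure (x : ∀ i j, X i j) :
    CSet.toFun (tensorCompHom X) (pure fun i => pure (x i)) =
      pure (X := flat X) fun k => x (finSigmaFinEquiv.symm k).1 (finSigmaFinEquiv.symm k).2 :=
  (desc_pure _ (exists_comp X).choose_spec.1 _).trans ((exists_comp X).choose_spec.2 x)

/-- The map `⊗₍ᵢⱼ₎ xᵢⱼ ↦ ⊗ᵢ ⊗ⱼ xᵢⱼ`. -/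
noncomputable def tensorCompInv : tensorObj (flat X) ⟶ tensorObj (fun i => tensorObj (X i)) :=
  desc (X := flat X) (fun y => pure fun i => pure fun j =>
      Equiv.piCongrLeft (fun s : Σ i, Fin (n i) => (X s.1 s.2 : Type u))
        finSigmaFinEquiv.symm y ⟨i, j⟩)
    (MultiConvex.reindex' (A := fun s : Σ i, Fin (n i) => (X s.1 s.2 : Type u))
      finSigmaFinEquiv.symm (pure_pure_multi X))

lemma tensorCompInv_pure (x : ∀ i j, X i j) :
    CSet.toFun (tensorCompInv X) (pure (X := flat X)
      fun k => x (finSigmaFinEquiv.symm k).1 (finSigmaFinEquiv.symm k).2) =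
      pure fun i => pure (x i) := by
  refine (desc_pure (X := flat X) _ (MultiConvex.reindex'
    (A := fun s : Σ i, Fin (n i) => (X s.1 s.2 : Type u))
      finSigmaFinEquiv.symm (pure_pure_multi X)) _).trans ?_
  have h := MultiConvex.piCongrLeft_comp finSigmaFinEquiv.symm
    (fun s : Σ i, Fin (n i) => (X s.1 s.2 : Type u)) (fun s => x s.1 s.2)
  exact congrArg (fun y : ∀ s : Σ i, Fin (n i), X s.1 s.2 =>
    (pure fun i => pure fun j => y ⟨i, j⟩ : tensorObj fun i => tensorObj (X i))) h

lemma exists_flat (A : ∀ i, Fin (n i) → Type*)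
    (y : ∀ k, flat A k) : ∃ x : ∀ i j, A i j,
    y = fun k => x (finSigmaFinEquiv.symm k).1 (finSigmaFinEquiv.symm k).2 :=
  ⟨fun i j => Equiv.piCongrLeft (fun s : Σ i, Fin (n i) => A s.1 s.2)
        finSigmaFinEquiv.symm y ⟨i, j⟩, funext fun k => (Equiv.piCongrLeft_apply_apply
      (fun s : Σ i, Fin (n i) => A s.1 s.2) finSigmaFinEquiv.symm y k).symm⟩

/-- The associativity isomorphism `⊗ᵢ ⊗ⱼ xᵢⱼ ↦ ⊗₍ᵢⱼ₎ xᵢⱼ`. -/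
noncomputable def tensorComp : tensorObj (fun i => tensorObj (X i)) ≅ tensorObj (flat X) where
  hom := tensorCompHom X
  inv := tensorCompInv X
  hom_inv_id := tensor_ext₂ fun x => by
    rw [CSet.toFun_comp, tensorCompHom_pure, tensorCompInv_pure]
    rfl
  inv_hom_id := tensor_ext fun y => by
    obtain ⟨x, rfl⟩ := exists_flat (fun i j => (X i j : Type u)) y
    rw [CSet.toFun_comp, tensorCompInv_pure, tensorCompHom_pure]
    rfl

end Comp

lemma toFun_eqToHom_pure {n : ℕ} {X Y : Fin n → CSet.{u}} (h : X = Y)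
    (h' : tensorObj X = tensorObj Y) (x : ∀ i, X i) (y : ∀ i, Y i) (hxy : ∀ i, HEq (x i) (y i)) :
    CSet.toFun (eqToHom h') (pure x) = pure y := by
  subst h
  obtain rfl : x = y := funext fun i => eq_of_heq (hxy i)
  rfl

lemma heq_sigma {ι : Type*} {A : ι → Type*} (x : ∀ i, A i) {i j : ι} (h : i = j) :
    HEq (x i) (x j) := by
  subst h
  rfl

lemma tensor_ext₃ {m : ℕ} {n : Fin m → ℕ} {p : ∀ i, Fin (n i) → ℕ}
    {X : ∀ i j, Fin (p i j) → CSet.{u}} {Z : CSet.{u}}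
    {f g : tensorObj (fun i => tensorObj fun j => tensorObj (X i j)) ⟶ Z}
    (h : ∀ x : ∀ i j l, X i j l, CSet.toFun f (pure fun i => pure fun j => pure (x i j)) =
      CSet.toFun g (pure fun i => pure fun j => pure (x i j))) : f = g :=
  (cancel_epi (tensorComp fun i j => tensorObj (X i j)).inv).1 <|
    tensor_ext₂ (X := fun k : Fin (∑ i, n i) =>
      X (finSigmaFinEquiv.symm k).1 (finSigmaFinEquiv.symm k).2) fun y => by
    obtain ⟨x, rfl⟩ := exists_flat (fun i j => ∀ l, (X i j l : Type u)) y
    have e := tensorCompInv_pure (fun i j => tensorObj (X i j)) fun i j => pure (x i j)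
    refine (congrArg (CSet.toFun f) e).trans ((h x).trans ?_)
    exact (congrArg (CSet.toFun g) e).symm

lemma tensor_unit_left {n : ℕ} (X : Fin n → CSet.{u}) :
    (tensorComp fun _ : Fin 1 => X).hom ≫ (tensorPerm (unitLeftEquiv n) X).hom =
      𝟙 (tensorObj X) :=
  tensor_ext₂ fun x => by
    refine (congrArg (CSet.toFun (tensorPerm (unitLeftEquiv n) X).hom)
      (tensorCompHom_pure (fun _ : Fin 1 => X) x)).trans ?_
    refine Eq.trans ?_ (tensorPerm_pure (unitLeftEquiv n) X (x 0))
    refine congrArg _ (congrArg pure (funext fun k => ?_))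
    exact congrArg (fun i => x i _) (Subsingleton.elim _ _)

lemma tensor_unit_right {m : ℕ} (X : Fin m → CSet.{u}) :
    (tensorComp fun (i : Fin m) (_ : Fin 1) => X i).hom ≫
      (tensorPerm (unitRightEquiv m) X).hom = 𝟙 (tensorObj X) :=
  tensor_ext₂ (X := fun (i : Fin m) (_ : Fin 1) => X i) fun x => by
    refine (congrArg (CSet.toFun (tensorPerm (unitRightEquiv m) X).hom)
      (tensorCompHom_pure (fun (i : Fin m) (_ : Fin 1) => X i) x)).trans ?_
    refine Eq.trans ?_ (tensorPerm_pure (unitRightEquiv m) X fun i => x i 0)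
    refine congrArg _ (congrArg pure (funext fun k => ?_))
    exact congrArg (fun j => x _ j) (Subsingleton.elim _ _)

lemma tensor_assoc {m : ℕ} {n : Fin m → ℕ} {p : ∀ i, Fin (n i) → ℕ}
    (X : ∀ i j, Fin (p i j) → CSet.{u}) :
    (tensorComp fun i j => tensorObj (X i j)).hom ≫
        (tensorComp fun k : Fin (∑ i, n i) =>
          X (finSigmaFinEquiv.symm k).1 (finSigmaFinEquiv.symm k).2).hom ≫
        eqToHom (congrArg tensorObj (flat_assocEquiv X)) ≫
        (tensorPerm (assocEquiv p) (flat fun i => flat (X i))).hom =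
      tensorMap (fun i => (tensorComp (X i)).hom) ≫ (tensorComp fun i => flat (X i)).hom :=
  tensor_ext₃ fun x => by
    simp only [CSet.toFun_comp]
    let y : ∀ k, (flat (fun i => flat (X i)) k : CSet.{u}) := fun k =>
      x (finSigmaFinEquiv.symm k).1
        (finSigmaFinEquiv.symm (finSigmaFinEquiv.symm k).2).1
        (finSigmaFinEquiv.symm (finSigmaFinEquiv.symm k).2).2
    have h1 := tensorCompHom_pure (fun i j => tensorObj (X i j)) fun i j => pure (x i j)
    have h2 := tensorCompHom_pure (fun k : Fin (∑ i, n i) =>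
      X (finSigmaFinEquiv.symm k).1 (finSigmaFinEquiv.symm k).2)
      (fun k => x (finSigmaFinEquiv.symm k).1 (finSigmaFinEquiv.symm k).2)
    have h3 := toFun_eqToHom_pure (flat_assocEquiv X) (congrArg tensorObj (flat_assocEquiv X))
      (fun k => x _ _ _) (fun k => y (assocEquiv p k)) fun k => by
        refine heq_sigma (fun t : Σ i, Σ j, Fin (p i j) => x t.1 t.2.1 t.2.2)
          (i := ⟨(finSigmaFinEquiv.symm (finSigmaFinEquiv.symm k).1).1,
            (finSigmaFinEquiv.symm (finSigmaFinEquiv.symm k).1).2, (finSigmaFinEquiv.symm k).2⟩)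
          (j := ⟨(finSigmaFinEquiv.symm (assocEquiv p k)).1,
            finSigmaFinEquiv.symm (finSigmaFinEquiv.symm (assocEquiv p k)).2⟩) ?_
        refine Eq.trans ?_ (congrArg (fun s : Σ i, Fin (∑ j, p i j) =>
          (⟨s.1, finSigmaFinEquiv.symm s.2⟩ : Σ i, Σ j, Fin (p i j)))
          (Equiv.symm_apply_apply finSigmaFinEquiv _)).symm
        exact congrArg (Sigma.mk _) (Equiv.symm_apply_apply finSigmaFinEquiv _).symm
    have h4 := tensorPerm_pure (assocEquiv p) (flat fun i => flat (X i)) y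
    have h5 := tensorCompHom_pure (fun i => flat (X i)) fun i k =>
      x i (finSigmaFinEquiv.symm k).1 (finSigmaFinEquiv.symm k).2
    have h6 : ∀ i, CSet.toFun (tensorComp (X i)).hom (pure fun j => pure (x i j)) = _ := fun i =>
      tensorCompHom_pure (X i) (x i)
    rw [tensorMap_pure, funext h6]
    refine Eq.trans ?_ h5.symm
    refine Eq.trans ?_ h4
    refine congrArg _ (Eq.trans (congrArg _ ?_) h3)
    exact (congrArg _ h1).trans h2

lemma tensor_blockSum {m : ℕ} {n n' : Fin m → ℕ} (σ : ∀ i, Fin (n i) ≃ Fin (n' i))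
    (X : ∀ i, Fin (n' i) → CSet.{u}) :
    (tensorComp fun i j => X i (σ i j)).hom ≫
        eqToHom (congrArg tensorObj (flat_blockSum σ X)) ≫
        (tensorPerm (blockSum σ) (flat X)).hom =
      tensorMap (fun i => (tensorPerm (σ i) (X i)).hom) ≫ (tensorComp X).hom :=
  tensor_ext₂ fun z => by
    obtain ⟨x, rfl⟩ : ∃ x : ∀ i j, X i j, z = fun i j => x i (σ i j) := by
      choose x hx using fun i => exists_reindex (σ i) (z i)
      exact ⟨x, funext hx⟩
    simp only [CSet.toFun_comp]
    let y : ∀ k, (flat X k : CSet.{u}) := fun k => x (finSigmaFinEquiv.symm k).1 (finSigmaFinEquiv.symm k).2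
    have h1 := tensorCompHom_pure (fun i j => X i (σ i j)) fun i j => x i (σ i j)
    have h3 := toFun_eqToHom_pure (flat_blockSum σ X) (congrArg tensorObj (flat_blockSum σ X))
      (fun k => x _ _) (fun k => y (blockSum σ k)) fun k =>
        heq_sigma (fun s : Σ i, Fin (n' i) => x s.1 s.2)
          (Equiv.symm_apply_apply finSigmaFinEquiv
            (Equiv.sigmaCongrRight σ (finSigmaFinEquiv.symm k))).symm
    have h4 := tensorPerm_pure (blockSum σ) (flat X) y
    have h5 := tensorCompHom_pure X x
    rw [tensorMap_pure, funext fun i => tensorPerm_pure (σ i) (X i) (x i)]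
    exact (congrArg _ ((congrArg _ h1).trans h3)).trans (h4.trans h5.symm)

lemma tensor_blockPerm {m m' : ℕ} {n : Fin m' → ℕ} (σ : Fin m ≃ Fin m')
    (X : ∀ i, Fin (n i) → CSet.{u}) :
    (tensorComp fun i => X (σ i)).hom ≫
        eqToHom (congrArg tensorObj (flat_blockPerm σ X)) ≫
        (tensorPerm (blockPerm n σ) (flat X)).hom =
      (tensorPerm σ (fun i => tensorObj (X i))).hom ≫ (tensorComp X).hom :=
  tensor_ext₂ fun z => by
    obtain ⟨x, rfl⟩ : ∃ x : ∀ i j, X i j, z = fun i => x (σ i) :=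
      ⟨Equiv.piCongrLeft (fun i => ∀ j, (X i j : Type u)) σ z, funext fun i =>
        (Equiv.piCongrLeft_apply_apply (fun i => ∀ j, (X i j : Type u)) σ z i).symm⟩
    simp only [CSet.toFun_comp]
    let y : ∀ k, (flat X k : CSet.{u}) := fun k => x (finSigmaFinEquiv.symm k).1 (finSigmaFinEquiv.symm k).2
    have h1 := tensorCompHom_pure (fun i => X (σ i)) fun i => x (σ i)
    have h3 := toFun_eqToHom_pure (flat_blockPerm σ X) (congrArg tensorObj (flat_blockPerm σ X))
      (fun k => x _ _) (fun k => y (blockPerm n σ k)) fun k =>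
        heq_sigma (fun s : Σ i, Fin (n i) => x s.1 s.2)
          (Equiv.symm_apply_apply finSigmaFinEquiv
            (Equiv.sigmaCongrLeft (β := fun i => Fin (n i)) σ (finSigmaFinEquiv.symm k))).symm
    have h4 := tensorPerm_pure (blockPerm n σ) (flat X) y
    have h5 := tensorCompHom_pure X x
    have h6 := tensorPerm_pure σ (fun i => tensorObj (X i)) fun i => pure (x i)
    exact (congrArg _ ((congrArg _ h1).trans h3)).trans
      (h4.trans ((congrArg _ h6).trans h5).symm)

/-- The trivial `O`-monoidal structure on convex sets given by the symmetric monoidal structure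
`⊗`: every `n`-ary operation of `O` acts by the `n`-fold convex tensor product. -/
noncomputable instance (O : SymmOperad.{w}) : OMonoidalCategory O CSet.{u} where
  tensor {n} _ := tensorFunctor n
  permIso := fun σ _ X => tensorPerm σ X
  permIso_naturality := @fun _ _ σ _ X Y f => tensor_ext fun y => by
    obtain ⟨x, rfl⟩ := exists_reindex σ y
    change CSet.toFun (tensorPerm σ Y).hom (CSet.toFun (tensorMap fun i => f (σ i)) _) =
      CSet.toFun (tensorMap f) (CSet.toFun (tensorPerm σ X).hom _)
    rw [tensorPerm_pure, tensorMap_pure, tensorMap_pure]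
    exact tensorPerm_pure σ Y fun i => CSet.toFun (f i) (x i)
  compIso := fun _ _ X => tensorComp X
  compIso_naturality := @fun m n _ _ X Y f => tensor_ext₂ fun x => by
    have h1 := tensorCompHom_pure X x
    have h2 := tensorCompHom_pure Y fun i j => CSet.toFun (f i j) (x i j)
    have h3 := tensorMap_pure (X := flat X) (Y := flat Y)
      (fun k => f (finSigmaFinEquiv.symm k).1 (finSigmaFinEquiv.symm k).2)
      (fun k => x (finSigmaFinEquiv.symm k).1 (finSigmaFinEquiv.symm k).2)
    have h4 : CSet.toFun (tensorMap fun i => tensorMap (f i)) (pure fun i => pure (x i)) =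
        pure fun i => pure fun j => CSet.toFun (f i j) (x i j) :=
      (tensorMap_pure _ _).trans (congrArg pure (funext fun i => tensorMap_pure (f i) (x i)))
    exact ((congrArg _ h4).trans h2).trans ((congrArg _ h1).trans h3).symm
  tensor_unit := CategoryTheory.Functor.ext (fun _ => rfl) fun X Y f => by
    refine Eq.trans ?_ ((Category.id_comp _).trans (Category.comp_id _)).symm
    exact tensor_ext fun x => tensorMap_pure f x
  permIso_refl := fun _ X => tensor_ext fun x => tensorPerm_pure (Equiv.refl _) X x
  permIso_trans := fun σ τ _ X => tensor_ext fun y => by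
    obtain ⟨x, rfl⟩ := exists_reindex (σ.trans τ) (X := X) y
    refine Eq.trans ?_ (tensorPerm_pure (σ.trans τ) X x).symm
    refine (congrArg _ (tensorPerm_pure σ (fun i => X (τ i)) fun i => x (τ i))).trans ?_
    exact tensorPerm_pure τ X x
  compIso_unit_left := fun _ X => tensor_unit_left X
  compIso_unit_right := fun _ X => tensor_unit_right X
  compIso_assoc := fun _ _ _ X => tensor_assoc X
  compIso_permIso := fun σ _ _ X => tensor_blockSum σ X
  permIso_compIso := fun σ _ _ X => tensor_blockPerm σ X

end TensorStructure

/-! ### Fibrations -/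

section Fibrations

open Convexity OMonoidalCategory

/-- Discrete fibrations (in the covariant sense): every morphism `f : π(e) ⟶ c` has a unique
lift with source `e`. -/
def IsDiscreteFibration {E : Type u₁} [Category.{v₁} E] {I : Type u₂} [Category.{v₂} I]
    (π : E ⥤ I) : Prop :=
  ∀ (e : E) {c : I} (f : π.obj e ⟶ c), ∃! p : (Σ e' : E, e ⟶ e'), π.IsHomLift f p.2

/-- The set `π⁻¹(f)` of morphisms lying over `f`. -/
structure MorFiber {E : Type u₁} [Category.{v₁} E] {I : Type u₂} [Category.{v₂} I]
    (π : E ⥤ I) {c d : I} (f : c ⟶ d) where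
  src : π.Fiber c
  tgt : π.Fiber d
  hom : src.1 ⟶ tgt.1
  lift : π.IsHomLift f hom

/-- Identity morphisms, as elements of `π⁻¹(𝟙 c)`. -/
def MorFiber.id {E : Type u₁} [Category.{v₁} E] {I : Type u₂} [Category.{v₂} I]
    {π : E ⥤ I} {c : I} (a : π.Fiber c) : MorFiber π (𝟙 c) :=
  ⟨a, a, 𝟙 a.1, IsHomLift.id a.2⟩

/-- A fibrewise convex structure: convex structures on all fibres `π⁻¹(c)` and `π⁻¹(f)` such that
the source, target and identity maps are convex. -/
structure FibrewiseConvex {E : Type u₁} [Category.{v₁} E] {I : Type u₂} [Category.{v₂} I]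
    (π : E ⥤ I) where
  [obj : ∀ c : I, ConvexSpace ℝ≥0 (π.Fiber c)]
  [mor : ∀ {c d : I} (f : c ⟶ d), ConvexSpace ℝ≥0 (MorFiber π f)]
  src_affine : ∀ {c d : I} (f : c ⟶ d), IsAffineMap ℝ≥0 fun φ : MorFiber π f => φ.src
  tgt_affine : ∀ {c d : I} (f : c ⟶ d), IsAffineMap ℝ≥0 fun φ : MorFiber π f => φ.tgt
  id_affine : ∀ c : I, IsAffineMap ℝ≥0 fun a : π.Fiber c => MorFiber.id a

/-- The map induced on fibres over objects by a functor over `I`. -/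
def fiberMap {E : Type u₁} [Category.{v₁} E] {E' : Type u₁} [Category.{v₁} E'] {I : Type u₂}
    [Category.{v₂} I] {π : E ⥤ I} {π' : E' ⥤ I} (f : E ⥤ E') (h : f ⋙ π' = π) (c : I)
    (a : π.Fiber c) : π'.Fiber c :=
  ⟨f.obj a.1, (Functor.congr_obj h a.1).trans a.2⟩

lemma isHomLift_map {E : Type u₁} [Category.{v₁} E] {E' : Type u₁} [Category.{v₁} E']
    {I : Type u₂} [Category.{v₂} I] {π : E ⥤ I} {π' : E' ⥤ I} (f : E ⥤ E') (h : f ⋙ π' = π)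
    {c d : I} {g : c ⟶ d} {a b : E} {φ : a ⟶ b} (hφ : π.IsHomLift g φ) :
    π'.IsHomLift g (f.map φ) := by
  subst h
  obtain ⟨⟩ := hφ
  exact IsHomLift.map π' (f.map φ)

/-- The map induced on fibres over morphisms by a functor over `I`. -/
def morFiberMap {E : Type u₁} [Category.{v₁} E] {E' : Type u₁} [Category.{v₁} E'] {I : Type u₂}
    [Category.{v₂} I] {π : E ⥤ I} {π' : E' ⥤ I} (f : E ⥤ E') (h : f ⋙ π' = π) {c d : I}
    (g : c ⟶ d) (φ : MorFiber π g) : MorFiber π' g where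
  src := fiberMap f h c φ.src
  tgt := fiberMap f h d φ.tgt
  hom := f.map φ.hom
  lift := isHomLift_map f h φ.lift

variable (O : SymmOperad.{w}) (I : Type u) [SmallCategory I] [OMonoidalCategory O I]

/-- `O`-monoidal fibrations over `I`: strict `O`-monoidal functors to `I` that are discrete
fibrations. -/
structure OFib where
  Total : Type u
  [category : SmallCategory Total]
  [monoidal : OMonoidalCategory O Total]
  proj : Total ⥤ I
  discrete : IsDiscreteFibration proj
  strict : IsStrict O proj

attribute [instance] OFib.category OFib.monoidal

/-- Fibrewise convex `O`-monoidal fibrations over `I`. -/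
structure OFCFib extends OFib O I where
  convex : FibrewiseConvex proj

variable {O I}

namespace OFCFib

instance (P : OFCFib O I) (c : I) : ConvexSpace ℝ≥0 (P.proj.Fiber c) := P.convex.obj c

instance (P : OFCFib O I) {c d : I} (f : c ⟶ d) : ConvexSpace ℝ≥0 (MorFiber P.proj f) :=
  P.convex.mor f

/-- Morphisms of fibrewise convex `O`-monoidal fibrations: strict `O`-monoidal functors over `I`
that are convex on all fibres over objects and over morphisms. -/
@[ext]
structure Hom (P Q : OFCFib O I) where
  functor : P.Total ⥤ Q.Total
  comm : functor ⋙ Q.proj = P.proj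
  strict : IsStrict O functor
  obj_affine : ∀ c : I, IsAffineMap ℝ≥0 (fiberMap functor comm c)
  mor_affine : ∀ {c d : I} (f : c ⟶ d), IsAffineMap ℝ≥0 (morFiberMap functor comm f)

end OFCFib

lemma IsStrict.id (C : Type u₁) [Category.{v₁} C] [OMonoidalCategory O C] :
    IsStrict O (𝟭 C) :=
  ⟨fun _ _ => rfl,
    { naturality := fun z X Y f => (Category.comp_id _).trans (Category.id_comp _).symm
      unit := fun X => rfl
      perm := fun σ z X => (Category.id_comp _).trans (Category.comp_id _).symm
      comp := fun {m n} z x X => by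
        have h := (tensor z).map_id (fun i => (tensor (x i)).obj (X i))
        refine (congrArg (fun t => t ≫ _) h).trans ?_
        refine (Category.id_comp _).trans ((Category.id_comp _).trans ?_)
        exact (Category.comp_id _).symm }⟩

section StrictComp

variable {C D E : Type u₁} [Category.{v₁} C] [OMonoidalCategory O C] [Category.{v₁} D]
  [OMonoidalCategory O D] [Category.{v₁} E] [OMonoidalCategory O E]

/-- Lax functors compose. -/
lemma IsLax.comp' {F : C ⥤ D} {G : D ⥤ E}
    {ξ : ∀ {n : ℕ} (z : O.Op n) (X : Fin n → C),
      (tensor z).obj (fun i => F.obj (X i)) ⟶ F.obj ((tensor z).obj X)}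
    {ζ : ∀ {n : ℕ} (z : O.Op n) (X : Fin n → D),
      (tensor z).obj (fun i => G.obj (X i)) ⟶ G.obj ((tensor z).obj X)}
    (hF : IsLax O F ξ) (hG : IsLax O G ζ) :
    IsLax O (F ⋙ G) (fun z X => ζ z (fun i => F.obj (X i)) ≫ G.map (ξ z X)) where
  naturality z X Y f := by
    have h1 := hG.naturality z (fun i => F.map (f i))
    have h2 := congrArg G.map (hF.naturality z f)
    rw [G.map_comp, G.map_comp] at h2
    simp only [Functor.comp_map, Category.assoc]
    rw [← h2, ← Category.assoc, ← Category.assoc]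
    exact congrArg (fun t => t ≫ _) h1
  unit X := by
    rw [hG.unit, hF.unit, eqToHom_map, eqToHom_trans]
  perm σ z X := by
    have h1 := hG.perm σ z (fun i => F.obj (X i))
    have h2 := congrArg G.map (hF.perm σ z X)
    rw [G.map_comp, G.map_comp] at h2
    simp only [Functor.comp_map, Category.assoc]
    rw [h2, ← Category.assoc, h1, Category.assoc]
    rfl
  comp {m n} z x X := by
    have h1 := hG.comp z x (fun i j => F.obj (X i j))
    have h2 := congrArg G.map (hF.comp z x X)
    have h3 := hG.naturality z (fun i => ξ (x i) (X i))
    have h4 := (tensor z).map_comp (X := fun i => (tensor (x i)).obj fun j => G.obj (F.obj (X i j)))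
      (Y := fun i => G.obj ((tensor (x i)).obj fun j => F.obj (X i j)))
      (Z := fun i => G.obj (F.obj ((tensor (x i)).obj (X i))))
      (fun i => ζ (x i) fun j => F.obj (X i j)) (fun i => G.map (ξ (x i) (X i)))
    simp only [G.map_comp] at h2
    refine (congrArg (fun t => t ≫ _) h4).trans ?_
    simp only [Functor.comp_map, Category.assoc]
    rw [reassoc_of% h3, h2]
    have h5 := congrArg (fun t => t ≫ G.map (ξ (O.comp z x) (flat X))) h1
    simp only [Category.assoc] at h5
    exact h5

lemma IsStrict.comp {F : C ⥤ D} {G : D ⥤ E} (hF : IsStrict O F) (hG : IsStrict O G) :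
    IsStrict O (F ⋙ G) := by
  obtain ⟨h, hF⟩ := hF
  obtain ⟨h', hG⟩ := hG
  refine ⟨fun z X => (h' z _).trans (congrArg G.obj (h z X)), ?_⟩
  have key := hF.comp' hG
  simp only [eqToHom_map, eqToHom_trans] at key
  exact key

end StrictComp

instance : Category (OFCFib O I) where
  Hom := OFCFib.Hom
  id P := ⟨𝟭 _, rfl, IsStrict.id _, fun _ => IsAffineMap.id, fun _ => IsAffineMap.id⟩
  comp {P Q R} f g := ⟨f.functor ⋙ g.functor, by rw [Functor.assoc, g.comm, f.comm],
    f.strict.comp g.strict, fun c => (g.obj_affine c).comp (f.obj_affine c),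
    fun φ => (g.mor_affine φ).comp (f.mor_affine φ)⟩
  id_comp _ := OFCFib.Hom.ext rfl
  comp_id _ := OFCFib.Hom.ext rfl
  assoc _ _ _ := OFCFib.Hom.ext rfl

/-- The map `π⁻¹(i₁) × ⋯ × π⁻¹(iₙ) → π⁻¹(z(i₁, …, iₙ))` induced by an operation `z`. -/
def OFib.fiberTensor (P : OFib O I) {n : ℕ} (z : O.Op n) (i : Fin n → I)
    (a : ∀ k, P.proj.Fiber (i k)) : P.proj.Fiber ((tensor z).obj i) :=
  ⟨(tensor z).obj fun k => (a k).1, by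
    obtain ⟨h, -⟩ := P.strict
    rw [← h z]
    exact congrArg (tensor z).obj (funext fun k => (a k).2)⟩

/-- `O`-convex fibrations: the operations are `n`-convex on fibres. -/
def IsOConvex : ObjectProperty (OFCFib O I) := fun P =>
  ∀ {n : ℕ} (z : O.Op n) (i : Fin n → I), MultiConvex (P.fiberTensor z i)

variable (O I) in
/-- The category of `O`-convex fibrations over `I`, a full subcategory of the category of
fibrewise convex `O`-monoidal fibrations. -/
abbrev OCFib := (IsOConvex (O := O) (I := I)).FullSubcategory

end Fibrations

/-! ### The convex `O`-monoidal Grothendieck construction -/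

section Grothendieck

open Convexity OMonoidalCategory

variable {O : SymmOperad.{w}} {I : Type u} [SmallCategory I] [OMonoidalCategory O I]

/-- The classical Grothendieck construction (category of elements) of the underlying functor to
sets of a lax `O`-monoidal functor to convex sets: objects are pairs `(i, x)` with `x ∈ F(i)`,
morphisms `(i, x) ⟶ (j, y)` are morphisms `f : i ⟶ j` with `F(f)(x) = y`. -/
abbrev Gr (F : LaxOFunctor O I CSet.{u}) : Type u := (F.toFunctor ⋙ CSet.forget).Elements

/-- The projection to `I`. -/
abbrev Gr.proj (F : LaxOFunctor O I CSet.{u}) : Gr F ⥤ I :=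
  CategoryOfElements.π (F.toFunctor ⋙ CSet.forget)

namespace Gr

variable (F : LaxOFunctor O I CSet.{u})

/-- The element `ξ (x₁ ⊗ ⋯ ⊗ xₙ)` of `F(z(i₁, …, iₙ))` associated with elements `xₖ ∈ F(iₖ)`. -/
noncomputable def xi {n : ℕ} (z : O.Op n) (X : Fin n → I) (x : ∀ k, F.toFunctor.obj (X k)) :
    F.toFunctor.obj ((tensor z).obj X) :=
  CSet.toFun (F.ξ z X) (pure x)

lemma xi_multi {n : ℕ} (z : O.Op n) (X : Fin n → I) :
    MultiConvex fun x : ∀ k, F.toFunctor.obj (X k) => xi F z X x :=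
  pure_multi.affine_comp (CSet.toFun_affine (F.ξ z X))

lemma xi_map {n : ℕ} (z : O.Op n) {X Y : Fin n → I} (f : ∀ k, X k ⟶ Y k)
    (x : ∀ k, F.toFunctor.obj (X k)) :
    CSet.toFun (F.toFunctor.map ((tensor z).map f)) (xi F z X x) =
      xi F z Y fun k => CSet.toFun (F.toFunctor.map (f k)) (x k) := by
  have h := congrArg (fun t => CSet.toFun t (pure x)) (F.isLax.naturality z f)
  exact h.symm.trans (congrArg (CSet.toFun (F.ξ z Y)) (tensorMap_pure _ x))

lemma xi_perm {m n : ℕ} (σ : Fin m ≃ Fin n) (z : O.Op m) (X : Fin n → I)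
    (x : ∀ k, F.toFunctor.obj (X k)) :
    CSet.toFun (F.toFunctor.map (permIso σ z X).hom) (xi F z (fun i => X (σ i)) fun i => x (σ i)) =
      xi F (O.relabel σ z) X x := by
  have h := congrArg (fun t => CSet.toFun t (pure fun i => x (σ i))) (F.isLax.perm σ z X)
  exact h.trans (congrArg (CSet.toFun (F.ξ (O.relabel σ z) X))
    (tensorPerm_pure σ (fun i => F.toFunctor.obj (X i)) x))

lemma xi_comp {m : ℕ} {n : Fin m → ℕ} (z : O.Op m) (x : ∀ i, O.Op (n i))
    (X : ∀ i, Fin (n i) → I) (y : ∀ i j, F.toFunctor.obj (X i j)) :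
    CSet.toFun (F.toFunctor.map (compIso z x X).hom)
      (xi F z (fun i => (tensor (x i)).obj (X i)) fun i => xi F (x i) (X i) (y i)) =
      xi F (O.comp z x) (flat X)
        fun k => y (finSigmaFinEquiv.symm k).1 (finSigmaFinEquiv.symm k).2 := by
  have h := congrArg (fun t => CSet.toFun t (pure fun i => pure (y i))) (F.isLax.comp z x X)
  have h1 := tensorMap_pure (fun i => F.ξ (x i) (X i)) fun i => pure (y i)
  have h2 := tensorCompHom_pure (fun i j => F.toFunctor.obj (X i j)) y
  refine Eq.trans ?_ (h.trans (congrArg (CSet.toFun (F.ξ (O.comp z x) (flat X))) h2))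
  exact congrArg (fun t => CSet.toFun (F.toFunctor.map (compIso z x X).hom)
    (CSet.toFun (F.ξ z fun i => (tensor (x i)).obj (X i)) t)) h1.symm

lemma xi_unit (X : Fin 1 → I) (x : ∀ k, F.toFunctor.obj (X k)) :
    CSet.toFun (F.toFunctor.map (eqToHom (congrArg (fun T => T.obj X)
      (tensor_unit (O := O) (C := I))))) (xi F O.unit X x) = x 0 := by
  have h : F.ξ O.unit X ≫ F.toFunctor.map (eqToHom (congrArg (fun T => T.obj X)
      (tensor_unit (O := O) (C := I)))) =
      eqToHom (congrArg (fun T => T.obj fun i => F.toFunctor.obj (X i))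
        (tensor_unit (O := O) (C := CSet.{u}))) := by
    rw [F.isLax.unit, eqToHom_map, eqToHom_trans]
    rfl
  exact congrArg (fun t => CSet.toFun t (pure x)) h

lemma val_eqToHom {P Q : Gr F} (h : P = Q) :
    (eqToHom h).1 = eqToHom (congrArg Sigma.fst h) := by
  subst h
  rfl

lemma hom_ext {P Q : Gr F} {f g : P ⟶ Q} (h : f.1 = g.1) : f = g := Subtype.ext h

/-- The operations of the `O`-monoidal structure on the Grothendieck construction:
`z((i₁, x₁), …, (iₙ, xₙ)) = (z(i₁, …, iₙ), ξ(x₁ ⊗ ⋯ ⊗ xₙ))`. -/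
noncomputable def tensorFunctor {n : ℕ} (z : O.Op n) : (Fin n → Gr F) ⥤ Gr F where
  obj P := ⟨(tensor z).obj fun k => (P k).1, xi F z _ fun k => (P k).2⟩
  map {P Q} f := ⟨(tensor z).map (X := fun k => (P k).1) (Y := fun k => (Q k).1)
    fun k => (f k).1, (xi_map F z _ _).trans
      (congrArg (xi F z fun k => (Q k).1) (funext fun k => (f k).2))⟩
  map_id P := Subtype.ext ((tensor z).map_id fun k => (P k).1)
  map_comp {P Q R} f g := Subtype.ext ((tensor z).map_comp (X := fun k => (P k).1)
    (Y := fun k => (Q k).1) (Z := fun k => (R k).1) (fun k => (f k).1) fun k => (g k).1)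

/-- The `O`-monoidal structure on the Grothendieck construction; its structure isomorphisms are
those of `I`. -/
noncomputable instance : OMonoidalCategory O (Gr F) where
  tensor := tensorFunctor F
  permIso := fun σ z X => CategoryOfElements.isoMk _ _ (permIso σ z fun k => (X k).1)
    (xi_perm F σ z _ fun k => (X k).2)
  permIso_naturality := @fun _ _ σ z X Y f => hom_ext F
    (permIso_naturality σ z (X := fun k => (X k).1) (Y := fun k => (Y k).1) fun k => (f k).1)
  compIso := fun z x X => CategoryOfElements.isoMk _ _ (compIso z x fun i j => (X i j).1)
    (xi_comp F z x _ fun i j => (X i j).2)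
  compIso_naturality := @fun _ _ z x X Y f => hom_ext F
    (compIso_naturality z x (X := fun i j => (X i j).1) (Y := fun i j => (Y i j).1)
      fun i j => (f i j).1)
  tensor_unit := CategoryTheory.Functor.ext
    (fun X => Functor.Elements.ext _ _
      (congrArg (fun T => T.obj fun k => (X k).1) (tensor_unit (O := O) (C := I)))
      (xi_unit F _ fun k => (X k).2))
    (fun X Y f => hom_ext F (by
      have h := Functor.congr_hom (tensor_unit (O := O) (C := I))
        (X := fun k => (X k).1) (Y := fun k => (Y k).1) fun k => (f k).1
      refine h.trans ?_
      rw [CategoryOfElements.comp_val, CategoryOfElements.comp_val, val_eqToHom, val_eqToHom]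
      rfl))
  permIso_refl := fun z X => hom_ext F (by
    rw [val_eqToHom]
    exact permIso_refl z fun k => (X k).1)
  permIso_trans := fun σ τ z X => hom_ext F (by
    refine (permIso_trans σ τ z fun k => (X k).1).trans ?_
    rw [CategoryOfElements.comp_val, val_eqToHom]
    rfl)
  compIso_unit_left := fun x X => hom_ext F (by
    rw [val_eqToHom]
    refine Eq.trans ?_ (compIso_unit_left x fun k => (X k).1)
    exact congrArg (fun t => _ ≫ _ ≫ t) (val_eqToHom F _))
  compIso_unit_right := fun z X => hom_ext F (by
    rw [val_eqToHom]
    refine Eq.trans ?_ (compIso_unit_right z fun k => (X k).1)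
    exact congrArg (fun t => _ ≫ _ ≫ t) (val_eqToHom F _))
  compIso_assoc := fun z x y X => hom_ext F (by
    refine Eq.trans ?_ (compIso_assoc z x y fun i j l => (X i j l).1)
    exact congrArg₂ (fun s t => _ ≫ _ ≫ s ≫ _ ≫ t) (val_eqToHom F _) (val_eqToHom F _))
  compIso_permIso := fun σ z x X => hom_ext F (by
    refine Eq.trans ?_ (compIso_permIso σ z x fun i j => (X i j).1)
    exact congrArg₂ (fun s t => _ ≫ s ≫ _ ≫ t) (val_eqToHom F _) (val_eqToHom F _))
  permIso_compIso := fun σ z x X => hom_ext F (by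
    refine Eq.trans ?_ (permIso_compIso σ z x fun i j => (X i j).1)
    exact congrArg₂ (fun s t => _ ≫ s ≫ _ ≫ t) (val_eqToHom F _) (val_eqToHom F _))

lemma proj_strict : IsStrict O (proj F) := by
  have h : ∀ {n : ℕ} (z : O.Op n) (X : Fin n → Gr F),
      (tensor z).obj (fun i => (proj F).obj (X i)) = (proj F).obj ((tensor z).obj X) :=
    fun _ _ => rfl
  have e : ∀ {n : ℕ} (z : O.Op n) (X : Fin n → Gr F),
      eqToHom (h z X) = 𝟙 ((tensor z).obj fun i => (X i).1) := fun z X => eqToHom_refl _ _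
  refine ⟨h, ?_⟩
  constructor
  · intro n z X Y f
    rw [e, e]
    exact (Category.comp_id _).trans (Category.id_comp _).symm
  · intro X
    rfl
  · intro m n σ z X
    rw [e, e]
    exact (Category.id_comp _).trans (Category.comp_id _).symm
  · intro m n z x X
    have h1 := (tensor z).map_id (fun i => (tensor (x i)).obj fun j => (X i j).1)
    have h2 : (tensor z).map (X := fun i => (tensor (x i)).obj fun j => (proj F).obj (X i j))
        (Y := fun i => (proj F).obj ((tensor (x i)).obj (X i)))
        (fun i => eqToHom (h (x i) (X i))) = 𝟙 _ :=
      (congrArg (tensor z).map (funext fun i => e (x i) (X i))).trans h1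
    rw [h2, e, e]
    refine (Category.id_comp _).trans ((Category.id_comp _).trans (Category.comp_id _).symm)

lemma proj_discrete : IsDiscreteFibration (proj F) := by
  rintro ⟨i, x⟩ c f
  refine ⟨⟨⟨c, CSet.toFun (F.toFunctor.map f) x⟩, ⟨f, rfl⟩⟩, ?_, ?_⟩
  · exact IsHomLift.map (proj F) (a := ⟨i, x⟩) (b := ⟨c, CSet.toFun (F.toFunctor.map f) x⟩)
      ⟨f, rfl⟩
  · rintro ⟨⟨c', y⟩, ⟨g, hg⟩⟩ h
    obtain rfl : c' = c := @IsHomLift.codomain_eq _ _ _ _ (proj F) _ _ _ _ f _ h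
    have e : f = g := @IsHomLift.eq_of_isHomLift _ _ _ _ (proj F) ⟨i, x⟩ ⟨c', y⟩ f ⟨g, hg⟩ h
    subst e
    clear h
    change CSet.toFun (F.toFunctor.map f) x = y at hg
    subst hg
    rfl


/-- The identification of the fibre over `i` with the convex set `F(i)`. -/
def fiberEquiv (i : I) : (proj F).Fiber i ≃ F.toFunctor.obj i where
  toFun a := CSet.toFun (F.toFunctor.map (eqToHom a.2)) a.1.2
  invFun x := ⟨⟨i, x⟩, rfl⟩
  left_inv := by
    rintro ⟨⟨j, x⟩, h⟩
    obtain rfl : j = i := h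
    exact Subtype.ext (congrArg (Sigma.mk j)
      (congrArg (fun t => CSet.toFun t x) (F.toFunctor.map_id j)))
  right_inv x := congrArg (fun t => CSet.toFun t x) (F.toFunctor.map_id i)

lemma fiberEquiv_tgt {c d : I} (f : c ⟶ d) (φ : MorFiber (proj F) f) :
    fiberEquiv F d φ.tgt = CSet.toFun (F.toFunctor.map f) (fiberEquiv F c φ.src) := by
  obtain ⟨⟨⟨c', x⟩, hc⟩, ⟨⟨d', y⟩, hd⟩, ⟨g, hg⟩, h⟩ := φ
  obtain rfl : c' = c := hc
  obtain rfl : d' = d := hd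
  have e : f = g := @IsHomLift.eq_of_isHomLift _ _ _ _ (proj F) ⟨c', x⟩ ⟨d', y⟩ f ⟨g, hg⟩ h
  subst e
  refine (congrArg (fun t => CSet.toFun t y) (F.toFunctor.map_id d')).trans ?_
  refine hg.symm.trans (congrArg (CSet.toFun (F.toFunctor.map f)) ?_)
  exact (congrArg (fun t => CSet.toFun t x) (F.toFunctor.map_id c')).symm

lemma morFiber_ext {c d : I} {f : c ⟶ d} {φ ψ : MorFiber (proj F) f} (h : φ.src = ψ.src) :
    φ = ψ := by
  have ht : φ.tgt = ψ.tgt := (fiberEquiv F d).injective (by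
    rw [fiberEquiv_tgt, fiberEquiv_tgt, h])
  obtain ⟨a, b, p, hp⟩ := φ
  obtain ⟨a', b', q, hq⟩ := ψ
  obtain rfl : a = a' := h
  obtain rfl : b = b' := ht
  have e : p = q := hom_ext F (by
    have h1 := @IsHomLift.fac' _ _ _ _ (proj F) _ _ _ _ f p hp
    have h2 := @IsHomLift.fac' _ _ _ _ (proj F) _ _ _ _ f q hq
    exact h1.trans h2.symm)
  subst e
  rfl

/-- The identification of the fibre over `f : c ⟶ d` with the convex set `F(c)`, through the
source. -/
def morFiberEquiv {c d : I} (f : c ⟶ d) : MorFiber (proj F) f ≃ F.toFunctor.obj c where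
  toFun φ := fiberEquiv F c φ.src
  invFun x :=
    { src := ⟨⟨c, x⟩, rfl⟩
      tgt := ⟨⟨d, CSet.toFun (F.toFunctor.map f) x⟩, rfl⟩
      hom := ⟨f, rfl⟩
      lift := IsHomLift.map (proj F) (a := ⟨c, x⟩) (b := ⟨d, CSet.toFun (F.toFunctor.map f) x⟩)
        ⟨f, rfl⟩ }
  left_inv φ := morFiber_ext F ((fiberEquiv F c).symm_apply_apply φ.src)
  right_inv x := (fiberEquiv F c).apply_symm_apply x

end Gr

/-- Transport of a convex structure along a bijection. -/
noncomputable abbrev convexTransport {A B : Type*} [ConvexSpace ℝ≥0 B] (e : A ≃ B) :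
    ConvexSpace ℝ≥0 A :=
  ConvexSpace.mk (fun P => e.symm (P.iConvexComb e))
    (fun a => by rw [iConvexComb_single, e.symm_apply_apply])
    (fun f => by
      rw [iConvexComb_map]
      have h := iConvexComb_assoc f (fun P => P) e
      rw [iConvexComb_id'] at h
      simp only [e.apply_symm_apply]
      rw [h])

lemma convexTransport_affine {A B : Type*} [ConvexSpace ℝ≥0 B] (e : A ≃ B) :
    letI := convexTransport e
    IsAffineMap ℝ≥0 e :=
  letI := convexTransport e
  ⟨fun _ => e.apply_symm_apply _⟩

lemma affine_of_injective {A B C : Type*} [ConvexSpace ℝ≥0 A] [ConvexSpace ℝ≥0 B]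
    [ConvexSpace ℝ≥0 C] {f : A → B} {e : B → C} (he : IsAffineMap ℝ≥0 e)
    (hi : Function.Injective e) (h : IsAffineMap ℝ≥0 fun a => e (f a)) : IsAffineMap ℝ≥0 f :=
  ⟨fun P => hi (by
    refine (h.map_sConvexComb P).trans ?_
    rw [he.map_sConvexComb, StdSimplex.map_map])⟩

lemma affine_congr {A B : Type*} [ConvexSpace ℝ≥0 A] [ConvexSpace ℝ≥0 B] {f g : A → B}
    (hf : IsAffineMap ℝ≥0 f) (h : ∀ a, g a = f a) : IsAffineMap ℝ≥0 g := by
  rwa [funext h]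

namespace Gr

variable (F : LaxOFunctor O I CSet.{u})

/-- The fibrewise convex structure of the Grothendieck construction: the fibre over `i` carries
the convex structure of `F(i)`, and a convex combination of morphisms `f : (c, xⱼ) ⟶ (d, yⱼ)` is
the morphism `f : (c, ∑ⱼ αⱼ xⱼ) ⟶ (d, ∑ⱼ αⱼ yⱼ)`. -/
noncomputable def fibrewiseConvex : FibrewiseConvex (proj F) :=
  letI (c : I) : ConvexSpace ℝ≥0 ((proj F).Fiber c) := convexTransport (fiberEquiv F c)
  letI {c d : I} (f : c ⟶ d) : ConvexSpace ℝ≥0 (MorFiber (proj F) f) :=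
    convexTransport (morFiberEquiv F f)
  { src_affine := fun {c d} f =>
      affine_of_injective (convexTransport_affine (fiberEquiv F c)) (fiberEquiv F c).injective
        (convexTransport_affine (morFiberEquiv F f))
    tgt_affine := fun {c d} f =>
      affine_of_injective (convexTransport_affine (fiberEquiv F d)) (fiberEquiv F d).injective (by
        have h := (CSet.toFun_affine (F.toFunctor.map f)).comp
          (convexTransport_affine (morFiberEquiv F f))
        have e : (fun φ : MorFiber (proj F) f => fiberEquiv F d φ.tgt) =
            CSet.toFun (F.toFunctor.map f) ∘ morFiberEquiv F f :=
          funext fun φ => fiberEquiv_tgt F f φ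
        rw [e]
        exact h)
    id_affine := fun c =>
      affine_of_injective (convexTransport_affine (morFiberEquiv F (𝟙 c)))
        (morFiberEquiv F (𝟙 c)).injective (convexTransport_affine (fiberEquiv F c)) }

/-- The Grothendieck construction as a fibrewise convex `O`-monoidal fibration. -/
noncomputable def toOFCFib : OFCFib O I where
  Total := Gr F
  proj := proj F
  discrete := proj_discrete F
  strict := proj_strict F
  convex := fibrewiseConvex F

lemma fiberEquiv_affine (c : I) : IsAffineMap ℝ≥0
    fun a : (toOFCFib F).proj.Fiber c => fiberEquiv F c a :=
  convexTransport_affine (fiberEquiv F c)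

lemma morFiberEquiv_affine {c d : I} (f : c ⟶ d) : IsAffineMap ℝ≥0
    fun φ : MorFiber (toOFCFib F).proj f => morFiberEquiv F f φ :=
  convexTransport_affine (morFiberEquiv F f)

lemma fiberEquiv_fiberTensor {n : ℕ} (z : O.Op n) (i : Fin n → I)
    (a : ∀ k, (toOFCFib F).proj.Fiber (i k)) :
    fiberEquiv F _ ((toOFCFib F).fiberTensor z i a) =
      xi F z i fun k => fiberEquiv F (i k) (a k) := by
  obtain ⟨x, rfl⟩ : ∃ x : ∀ k, F.toFunctor.obj (i k), a = fun k => (fiberEquiv F (i k)).symm (x k) :=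
    ⟨fun k => fiberEquiv F (i k) (a k),
      funext fun k => ((fiberEquiv F (i k)).symm_apply_apply (a k)).symm⟩
  refine ((fiberEquiv F _).right_inv (xi F z i x)).trans (congrArg (xi F z i) (funext fun k => ?_))
  exact ((fiberEquiv F (i k)).apply_symm_apply (x k)).symm

lemma isOConvex : IsOConvex (toOFCFib F) := by
  intro n z i k a
  refine affine_of_injective (fiberEquiv_affine F _) (fiberEquiv F _).injective ?_
  have h := (xi_multi F z i k fun k => fiberEquiv F (i k) (a k)).comp (fiberEquiv_affine F (i k))
  refine (congrArg (IsAffineMap ℝ≥0) (funext fun b => ?_)).mpr h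
  refine (fiberEquiv_fiberTensor F z i _).trans (congrArg (xi F z i) (funext fun l => ?_))
  by_cases hl : l = k
  · subst hl
    simp
  · simp [hl]

section Map

variable {F} {G H : LaxOFunctor O I CSet.{u}}

/-- The functor between Grothendieck constructions induced by an `O`-monoidal transformation `μ`:
it sends `(i, x)` to `(i, μᵢ(x))` and `f` to `f`. -/
abbrev map (μ : F ⟶ G) : Gr F ⥤ Gr G :=
  CategoryOfElements.map (Functor.whiskerRight μ.toNatTrans CSet.forget)

lemma map_xi (μ : F ⟶ G) {n : ℕ} (z : O.Op n) (X : Fin n → I)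
    (x : ∀ k, F.toFunctor.obj (X k)) :
    xi G z X (fun k => CSet.toFun (μ.toNatTrans.app (X k)) (x k)) =
      CSet.toFun (μ.toNatTrans.app ((tensor z).obj X)) (xi F z X x) := by
  have h := congrArg (fun t => CSet.toFun t (pure x)) (μ.comm z X)
  refine Eq.trans ?_ h
  exact congrArg (CSet.toFun (G.ξ z X))
    (tensorMap_pure (fun k => μ.toNatTrans.app (X k)) x).symm

lemma map_strict (μ : F ⟶ G) : IsStrict O (map μ) := by
  have h : ∀ {n : ℕ} (z : O.Op n) (X : Fin n → Gr F),
      (tensor z).obj (fun i => (map μ).obj (X i)) = (map μ).obj ((tensor z).obj X) :=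
    fun z X => congrArg (Sigma.mk _) (map_xi μ z (fun k => (X k).1) fun k => (X k).2)
  have e : ∀ {n : ℕ} (z : O.Op n) (X : Fin n → Gr F),
      (eqToHom (h z X)).1 = 𝟙 ((tensor z).obj fun i => (X i).1) := fun z X =>
    (val_eqToHom G _).trans (eqToHom_refl _ _)
  refine ⟨h, ?_⟩
  constructor
  · intro n z X Y f
    refine hom_ext G ?_
    rw [CategoryOfElements.comp_val, CategoryOfElements.comp_val, e, e]
    exact (Category.comp_id _).trans (Category.id_comp _).symm
  · intro X
    rfl
  · intro m n σ z X
    refine hom_ext G ?_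
    rw [CategoryOfElements.comp_val, CategoryOfElements.comp_val, e, e]
    exact (Category.id_comp _).trans (Category.comp_id _).symm
  · intro m n z x X
    refine hom_ext G ?_
    have h1 := (tensor z).map_id (fun i => (tensor (x i)).obj fun j => (X i j).1)
    have h2 : ((tensor z).map (X := fun i => (tensor (x i)).obj fun j => (map μ).obj (X i j))
        (Y := fun i => (map μ).obj ((tensor (x i)).obj (X i)))
        (fun i => eqToHom (h (x i) (X i)))).1 =
        𝟙 ((tensor z).obj fun i => (tensor (x i)).obj fun j => (X i j).1) :=
      (congrArg (tensor z).map (funext fun i => e (x i) (X i))).trans h1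
    rw [CategoryOfElements.comp_val, CategoryOfElements.comp_val, CategoryOfElements.comp_val,
      h2, e, e]
    exact (Category.id_comp _).trans ((Category.id_comp _).trans (Category.comp_id _).symm)

lemma map_comm (μ : F ⟶ G) : map μ ⋙ proj G = proj F := rfl

lemma fiberEquiv_map (μ : F ⟶ G) (c : I) (a : (proj F).Fiber c) :
    fiberEquiv G c (fiberMap (map μ) (map_comm μ) c a) =
      CSet.toFun (μ.toNatTrans.app c) (fiberEquiv F c a) := by
  obtain ⟨x, rfl⟩ := (fiberEquiv F c).symm.surjective a
  refine ((fiberEquiv G c).right_inv (CSet.toFun (μ.toNatTrans.app c) x)).trans ?_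
  rw [Equiv.apply_symm_apply]

lemma map_obj_affine (μ : F ⟶ G) (c : I) : IsAffineMap ℝ≥0
    (fiberMap (π := (toOFCFib F).proj) (π' := (toOFCFib G).proj) (map μ) (map_comm μ) c) :=
  affine_of_injective (fiberEquiv_affine G c) (fiberEquiv G c).injective
    (affine_congr ((CSet.toFun_affine (μ.toNatTrans.app c)).comp (fiberEquiv_affine F c))
      (fiberEquiv_map μ c))

lemma map_mor_affine (μ : F ⟶ G) {c d : I} (f : c ⟶ d) : IsAffineMap ℝ≥0
    (morFiberMap (π := (toOFCFib F).proj) (π' := (toOFCFib G).proj) (map μ) (map_comm μ) f) :=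
  affine_of_injective (morFiberEquiv_affine G f) (morFiberEquiv G f).injective
    (affine_congr ((CSet.toFun_affine (μ.toNatTrans.app c)).comp (morFiberEquiv_affine F f))
      (g := fun φ : MorFiber (toOFCFib F).proj f => morFiberEquiv G f (morFiberMap (map μ) (map_comm μ) f φ))
      fun φ => fiberEquiv_map μ c φ.src)

/-- The morphism of fibrewise convex `O`-monoidal fibrations induced by an `O`-monoidal
transformation. -/
def mapHom (μ : F ⟶ G) : toOFCFib F ⟶ toOFCFib G where
  functor := map μ
  comm := map_comm μ
  strict := map_strict μ
  obj_affine := map_obj_affine μ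
  mor_affine := map_mor_affine μ

end Map

end Gr

variable (O I) in
/-- The convex `O`-monoidal Grothendieck construction, as a functor from lax `O`-monoidal functors
`I ⥤ CSet` and `O`-monoidal transformations to `O`-convex fibrations over `I`. -/
noncomputable def convexGrothendieck : LaxOFunctor O I CSet.{u} ⥤ OCFib O I where
  obj F := ⟨Gr.toOFCFib F, Gr.isOConvex F⟩
  map μ := ObjectProperty.homMk (Gr.mapHom μ)
  map_id F := by
    ext1
    refine OFCFib.Hom.ext ?_
    change Gr.map (𝟙 F) = 𝟭 _
    rfl
  map_comp μ ν := by
    ext1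
    refine OFCFib.Hom.ext ?_
    change Gr.map (μ ≫ ν) = Gr.map μ ⋙ Gr.map ν
    rfl

end Grothendieck

end ConvexGC

namespace ConvexGC

open Convexity OMonoidalCategory

/-! ### Discrete fibrations -/

section DiscreteFibration

variable {E : Type u₁} [Category.{v₁} E] {I : Type u₂} [Category.{v₂} I] {π : E ⥤ I}

/-! The quasi-inverse sends an `O`-convex fibration `π : C → I` to its functor of fibres: `c ↦
π⁻¹(c)`, with a morphism `f : c ⟶ d` acting by transport, i.e. `a` goes to the target of the unique
lift of `f` starting at `a`. Transport is convex because the source map on `π⁻¹(f)` is a convex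
bijection onto `π⁻¹(c)`, so its inverse is convex, and the target map is convex too (`push_affine`).
The operations of `C` are `n`-convex on fibres, so the universal property of the tensor product
turns them into the structure maps `ξ` of a lax functor (`fiberXi`, `fiberXi_isLax`).

Coherence is never checked by hand, since in a discrete fibration a morphism is determined by its
endpoints and its image in `I` (`IsDiscreteFibration.hom_ext`). Strictness of `π` says that the
tensor of lifts and the structure isomorphisms of `C` lie over their counterparts in `I`
(`tensor_isHomLift`, `permIso_isHomLift`, `compIso_isHomLift`). Two consequences carry the proof. By
`push_eq`, these morphisms of `C` compute the transport along their images, which gives the axioms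
for `ξ` on pure tensors. By `IsStrict.of_obj`, a functor over `I` is strict as soon as it commutes
with the operations on objects. Convexity on fibres over morphisms likewise follows from convexity
on fibres over objects. Hence a morphism of `O`-convex fibrations is determined by its action on
objects, and only object-level conditions are needed to construct one (`homOfObj`, `hom_ext_obj`).

Faithfulness can then be read off on objects `(c, x)`. For fullness, a morphism of Grothendieck
constructions restricts to convex maps of fibres `F(c) → G(c)`; it commutes with transport, which is
naturality, and with the operations, which is compatibility with `ξ` (`preimage`). For essential
surjectivity, `(c, x) ↦ x` is an isomorphism from the Grothendieck construction of the functor of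
fibres to the given fibration (`comparisonIso`). -/

lemma IsDiscreteFibration.hom_ext (hπ : IsDiscreteFibration π) {R S : I} {f : R ⟶ S} {a b : E}
    {φ ψ : a ⟶ b} (hφ : π.IsHomLift f φ) (hψ : π.IsHomLift f ψ) : φ = ψ := by
  obtain rfl := IsHomLift.domain_eq π f φ
  have h : (⟨b, φ⟩ : Σ b, a ⟶ b) = ⟨b, ψ⟩ := (hπ a f).unique hφ hψ
  simpa using h

lemma IsDiscreteFibration.tgt_unique (hπ : IsDiscreteFibration π) {R S : I} {f : R ⟶ S}
    {a b b' : E} {φ : a ⟶ b} {ψ : a ⟶ b'} (hφ : π.IsHomLift f φ) (hψ : π.IsHomLift f ψ) :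
    b = b' := by
  obtain rfl := IsHomLift.domain_eq π f φ
  have h : (⟨b, φ⟩ : Σ b, a ⟶ b) = ⟨b', ψ⟩ := (hπ a f).unique hφ hψ
  exact congrArg Sigma.fst h

/-- The values on morphisms are forced: `K.map f` and `L.map f` lie over the same morphism of the
base. This makes equality of morphisms of fibrations a question about objects. -/
lemma IsDiscreteFibration.functor_ext (hπ : IsDiscreteFibration π) {E' : Type*} [Category* E']
    {K L : E' ⥤ E} (h : K ⋙ π = L ⋙ π) (hobj : ∀ e, K.obj e = L.obj e) : K = L :=
  CategoryTheory.Functor.ext hobj fun a b f => by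
    have h1 : π.IsHomLift ((K ⋙ π).map f) (K.map f) := IsHomLift.map π (K.map f)
    have h2 : π.IsHomLift ((L ⋙ π).map f) (L.map f) := IsHomLift.map π (L.map f)
    -- The rewritten base morphism is the image of `L.map f` conjugated by `eqToHom`, matching the
    -- conjugate of `L.map f` in the goal; instance search finds that lift from `h2`.
    rw [Functor.congr_hom h f] at h1
    exact hπ.hom_ext h1 inferInstance

/-- Unique lifting restated as bijectivity of the source map `π⁻¹(f) → π⁻¹(c)`. In this form it can
be combined with the convexity of the source map. -/
lemma IsDiscreteFibration.existsUnique_morFiber (hπ : IsDiscreteFibration π) {c d : I}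
    (f : c ⟶ d) (a : π.Fiber c) : ∃! φ : MorFiber π f, φ.src = a := by
  obtain ⟨a, rfl⟩ := a
  obtain ⟨⟨b, p⟩, hp, -⟩ := hπ a f
  refine ⟨⟨⟨a, rfl⟩, ⟨b, @IsHomLift.codomain_eq _ _ _ _ _ _ _ _ _ f p hp⟩, p, hp⟩, rfl, ?_⟩
  rintro ⟨a', ⟨b', hb'⟩, q, hq⟩ (rfl : a' = _)
  obtain rfl := hπ.tgt_unique hp hq
  obtain rfl := hπ.hom_ext hp hq
  rfl

/-- The lift of `f` with source `a`. -/
noncomputable def IsDiscreteFibration.liftFrom (hπ : IsDiscreteFibration π) {c d : I}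
    (f : c ⟶ d) (a : π.Fiber c) : MorFiber π f :=
  (hπ.existsUnique_morFiber f a).choose

lemma IsDiscreteFibration.liftFrom_src (hπ : IsDiscreteFibration π) {c d : I} (f : c ⟶ d)
    (a : π.Fiber c) : (hπ.liftFrom f a).src = a :=
  (hπ.existsUnique_morFiber f a).choose_spec.1

lemma IsDiscreteFibration.src_injective (hπ : IsDiscreteFibration π) {c d : I} (f : c ⟶ d) :
    Function.Injective fun φ : MorFiber π f => φ.src :=
  fun _ ψ h => (hπ.existsUnique_morFiber f ψ.src).unique h rfl

/-- The transport of objects along `f`: the target of the lift of `f` with given source. -/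
noncomputable def IsDiscreteFibration.push (hπ : IsDiscreteFibration π) {c d : I}
    (f : c ⟶ d) (a : π.Fiber c) : π.Fiber d :=
  (hπ.liftFrom f a).tgt

/-- The main tool for computing transports: by uniqueness of lifts, any morphism over `f` starting
at `a` identifies its target with the transport of `a`, so it suffices to exhibit one. -/
lemma IsDiscreteFibration.push_eq (hπ : IsDiscreteFibration π) {c d : I} {f : c ⟶ d}
    {a : π.Fiber c} {b : π.Fiber d} {φ : a.1 ⟶ b.1} (hφ : π.IsHomLift f φ) : hπ.push f a = b := by
  have h : hπ.liftFrom f a = ⟨a, b, φ, hφ⟩ := hπ.src_injective f (hπ.liftFrom_src f a)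
  exact congrArg MorFiber.tgt h

/-- The morphism from `a` to its transport along `f`. -/
noncomputable def IsDiscreteFibration.toPush (hπ : IsDiscreteFibration π) {c d : I}
    (f : c ⟶ d) (a : π.Fiber c) : a.1 ⟶ (hπ.push f a).1 :=
  eqToHom (congrArg Subtype.val (hπ.liftFrom_src f a).symm) ≫ (hπ.liftFrom f a).hom

instance IsDiscreteFibration.toPush_lift (hπ : IsDiscreteFibration π) {c d : I}
    (f : c ⟶ d) (a : π.Fiber c) : π.IsHomLift f (hπ.toPush f a) :=
  (IsHomLift.comp_eqToHom_lift_iff π f _ _).2 (hπ.liftFrom f a).lift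

lemma IsDiscreteFibration.push_id (hπ : IsDiscreteFibration π) {c : I} (a : π.Fiber c) :
    hπ.push (𝟙 c) a = a :=
  hπ.push_eq (IsHomLift.id a.2)

lemma IsDiscreteFibration.push_comp (hπ : IsDiscreteFibration π) {c d e : I} (f : c ⟶ d)
    (g : d ⟶ e) (a : π.Fiber c) : hπ.push (f ≫ g) a = hπ.push g (hπ.push f a) :=
  hπ.push_eq (φ := hπ.toPush f a ≫ hπ.toPush g (hπ.push f a)) inferInstance

end DiscreteFibration

/-! ### Strict functors and lifts of structure morphisms -/

section Strict

variable {O : SymmOperad.{w}} {C : Type u₁} [Category.{v₁} C] [OMonoidalCategory O C]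
  {D : Type u₂} [Category.{v₂} D] [OMonoidalCategory O D]

lemma map_eqToHom_pi {ι : Type*} (T : (ι → C) ⥤ D) {A B : ι → C} (h : ∀ i, A i = B i) :
    T.map (X := A) (Y := B) (fun i => eqToHom (h i)) = eqToHom (congrArg T.obj (funext h)) := by
  obtain rfl := funext h
  exact T.map_id A

/-- Brings the commuting squares supplied by `IsLax` for a strict functor into the form of the
factorisation that `IsHomLift.of_fac` expects. -/
lemma eq_eqToHom_comp_of_comp_eqToHom {X Y X' Y' : C} {f : X ⟶ Y} {g : X' ⟶ Y'} (hX : X = X')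
    (hY : Y = Y') (h : f ≫ eqToHom hY = eqToHom hX ≫ g) :
    f = eqToHom hX ≫ g ≫ eqToHom hY.symm := by
  subst hX hY
  simpa using h

variable {π : C ⥤ D} (hπ : IsStrict O π)
include hπ

/-- Once the base data are replaced by the images of the `φ k`, this is the naturality square of the
identity structure maps of `π`. -/
lemma IsStrict.tensor_isHomLift {n : ℕ} (z : O.Op n) {X Y : Fin n → D} {A B : Fin n → C}
    {f : ∀ k, X k ⟶ Y k} {φ : ∀ k, A k ⟶ B k} (h : ∀ k, π.IsHomLift (f k) (φ k)) :
    π.IsHomLift ((tensor z).map f) ((tensor z).map φ) := by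
  obtain rfl : (fun k => π.obj (A k)) = X := funext fun k => IsHomLift.domain_eq π (f k) (φ k)
  obtain rfl : (fun k => π.obj (B k)) = Y := funext fun k => IsHomLift.codomain_eq π (f k) (φ k)
  obtain rfl : f = fun k => π.map (φ k) :=
    funext fun k => @IsHomLift.eq_of_isHomLift _ _ _ _ π _ _ (f k) (φ k) (h k)
  obtain ⟨e, hl⟩ := hπ
  exact IsHomLift.of_fac π _ _ (e z A).symm (e z B).symm
    (eq_eqToHom_comp_of_comp_eqToHom _ _ (hl.naturality z φ))

lemma IsStrict.permIso_isHomLift {m n : ℕ} (σ : Fin m ≃ Fin n) (z : O.Op m) {X : Fin n → D}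
    {A : Fin n → C} (h : ∀ k, π.obj (A k) = X k) :
    π.IsHomLift (permIso σ z X).hom (permIso σ z A).hom := by
  obtain rfl := funext h
  obtain ⟨e, hl⟩ := hπ
  exact IsHomLift.of_fac π _ _ (e z _).symm (e _ A).symm
    (eq_eqToHom_comp_of_comp_eqToHom _ _ (hl.perm σ z A).symm)

lemma IsStrict.compIso_isHomLift {m : ℕ} {n : Fin m → ℕ} (z : O.Op m) (x : ∀ i, O.Op (n i))
    {X : ∀ i, Fin (n i) → D} {A : ∀ i, Fin (n i) → C} (h : ∀ i j, π.obj (A i j) = X i j) :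
    π.IsHomLift (compIso z x X).hom (compIso z x A).hom := by
  obtain rfl : (fun i j => π.obj (A i j)) = X := funext fun i => funext (h i)
  obtain ⟨e, hl⟩ := hπ
  have h1 := hl.comp z x A
  -- Strictness is used at both levels of the nested operation; the two resulting identity maps
  -- merge into a single `eqToHom`.
  rw [map_eqToHom_pi, ← Category.assoc, eqToHom_trans] at h1
  have h2 := congrArg (tensor z).obj (funext fun i => e (x i) (A i))
  exact IsHomLift.of_fac π _ _ (h2.trans (e z _)).symm (e (O.comp z x) (flat A)).symm
    (eq_eqToHom_comp_of_comp_eqToHom _ _ h1.symm)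

omit hπ in
/-- A functor over the base of a discrete fibration is strict as soon as it commutes with the
operations on objects. -/
lemma IsStrict.of_obj {E E' : Type u₁} [Category.{v₁} E] [OMonoidalCategory O E]
    [Category.{v₁} E'] [OMonoidalCategory O E'] {p : E ⥤ D} {p' : E' ⥤ D} (hp : IsStrict O p)
    (hp' : IsStrict O p') (hd : IsDiscreteFibration p') {K : E ⥤ E'} (hK : K ⋙ p' = p)
    (h : ∀ {n : ℕ} (z : O.Op n) (X : Fin n → E),
      (tensor z).obj (fun i => K.obj (X i)) = K.obj ((tensor z).obj X)) :
    IsStrict O K := by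
  have hobj : ∀ e, p'.obj (K.obj e) = p.obj e := Functor.congr_obj hK
  -- Naturality and the axioms for permutations and composition each equate two parallel morphisms
  -- of `E'` lying over the same morphism of `D`, since composing with an `eqToHom` does not change
  -- what a morphism lies over. Uniqueness of lifts then gives the equality.
  refine ⟨h, ?_, ?_, ?_, ?_⟩
  · intro n z X Y f
    have h1 := hp'.tensor_isHomLift z (A := fun i => K.obj (X i)) (B := fun i => K.obj (Y i))
      (φ := fun i => K.map (f i)) fun i => isHomLift_map K hK (IsHomLift.map p (f i))
    have h2 := isHomLift_map K hK (hp.tensor_isHomLift z fun i => IsHomLift.map p (f i))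
    exact hd.hom_ext ((IsHomLift.eqToHom_comp_lift_iff p' _ _ _).2 h1)
      ((IsHomLift.comp_eqToHom_lift_iff p' _ _ _).2 h2)
  -- Here both sides are `eqToHom` of proofs of the same equation, so proof irrelevance suffices.
  · intro X
    rfl
  · intro m n σ z X
    have h1 := hp'.permIso_isHomLift σ z fun i => hobj (X i)
    have h2 := isHomLift_map K hK (hp.permIso_isHomLift σ z (A := X) fun i => rfl)
    exact hd.hom_ext ((IsHomLift.comp_eqToHom_lift_iff p' _ _ _).2 h2)
      ((IsHomLift.eqToHom_comp_lift_iff p' _ _ _).2 h1)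
  · intro m n z x X
    have h1 := hp'.compIso_isHomLift z x fun i j => hobj (X i j)
    have h2 := isHomLift_map K hK (hp.compIso_isHomLift z x (A := X) fun i j => rfl)
    rw [map_eqToHom_pi, ← Category.assoc, eqToHom_trans]
    exact hd.hom_ext ((IsHomLift.comp_eqToHom_lift_iff p' _ _ _).2 h2)
      ((IsHomLift.eqToHom_comp_lift_iff p' _ _ _).2 h1)

end Strict

variable {O : SymmOperad.{w}} {I : Type u} [SmallCategory I] [OMonoidalCategory O I]

/-! ### The lax functor of fibres of an `O`-convex fibration -/

namespace OFCFib

variable (P : OFCFib O I)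

/-- Lifting is a section of the source map, which is convex and injective, so convexity may be
tested after composing with it, where the map becomes the identity. -/
lemma liftFrom_affine {c d : I} (f : c ⟶ d) :
    IsAffineMap ℝ≥0 fun a : P.proj.Fiber c => P.discrete.liftFrom f a :=
  affine_of_injective (P.convex.src_affine f) (P.discrete.src_injective f)
    (affine_congr IsAffineMap.id (P.discrete.liftFrom_src f))

lemma push_affine {c d : I} (f : c ⟶ d) :
    IsAffineMap ℝ≥0 fun a : P.proj.Fiber c => P.discrete.push f a :=
  (P.convex.tgt_affine f).comp (P.liftFrom_affine f)

/-- The functor of fibres. -/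
noncomputable def fiberFunctor : I ⥤ CSet.{u} where
  obj c := ⟨P.proj.Fiber c⟩
  map f := CSet.ofFun (X := ⟨P.proj.Fiber _⟩) (Y := ⟨P.proj.Fiber _⟩) _ (P.push_affine f)
  map_id c := CSet.hom_ext fun a : P.proj.Fiber c => P.discrete.push_id a
  map_comp {c _ _} f g := CSet.hom_ext fun a : P.proj.Fiber c => P.discrete.push_comp f g a

/-- Needed for the unit axiom, whose structure map is an `eqToHom` in `CSet` between fibres over
equal objects. -/
lemma fiberFunctor_eqToHom {c d : I} (h : c = d)
    (h' : P.fiberFunctor.obj c = P.fiberFunctor.obj d) (a : P.proj.Fiber c) :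
    ((CSet.toFun (eqToHom h') a : P.proj.Fiber d)).1 = a.1 := by
  subst h
  rfl

/-- The operation `z` applied to the lifts `a k ⟶ push (f k) (a k)` is a lift of `z` applied to the
`f k`, and its target is the right-hand side. -/
lemma fiberTensor_push {n : ℕ} (z : O.Op n) {X Y : Fin n → I} (f : ∀ k, X k ⟶ Y k)
    (a : ∀ k, P.proj.Fiber (X k)) :
    P.discrete.push ((tensor z).map f) (P.fiberTensor z X a) =
      P.fiberTensor z Y fun k => P.discrete.push (f k) (a k) :=
  P.discrete.push_eq (P.strict.tensor_isHomLift z fun k => P.discrete.toPush_lift (f k) (a k))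

/-- The permutation isomorphism of the total category is itself a lift of the one in `I`, with the
required source and target. The composition isomorphisms below are treated the same way. -/
lemma fiberTensor_perm {m n : ℕ} (σ : Fin m ≃ Fin n) (z : O.Op m) (X : Fin n → I)
    (a : ∀ k, P.proj.Fiber (X k)) :
    P.discrete.push (permIso σ z X).hom (P.fiberTensor z (fun i => X (σ i)) fun i => a (σ i)) =
      P.fiberTensor (O.relabel σ z) X a :=
  P.discrete.push_eq (P.strict.permIso_isHomLift σ z fun k => (a k).2)

lemma fiberTensor_comp {m : ℕ} {n : Fin m → ℕ} (z : O.Op m) (x : ∀ i, O.Op (n i))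
    (X : ∀ i, Fin (n i) → I) (a : ∀ i j, P.proj.Fiber (X i j)) :
    P.discrete.push (compIso z x X).hom
      (P.fiberTensor z (fun i => (tensor (x i)).obj (X i)) fun i =>
        P.fiberTensor (x i) (X i) (a i)) =
      P.fiberTensor (O.comp z x) (flat X)
        fun k => a (finSigmaFinEquiv.symm k).1 (finSigmaFinEquiv.symm k).2 :=
  P.discrete.push_eq (P.strict.compIso_isHomLift z x fun i j => (a i j).2)

/-- Stated for underlying objects because the two elements live in fibres over base objects that are
equal only propositionally. -/
lemma fiberTensor_unit (X : Fin 1 → I) (a : ∀ k, P.proj.Fiber (X k)) :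
    (P.fiberTensor O.unit X a).1 = (a 0).1 :=
  congrArg (fun T => T.obj fun k => (a k).1) (tensor_unit (O := O) (C := P.Total))

variable {P} (hP : IsOConvex P)

/-- The structure maps of the functor of fibres, induced by the operations on the fibration. -/
noncomputable def fiberXi {n : ℕ} (z : O.Op n) (X : Fin n → I) :
    tensorObj (fun i => P.fiberFunctor.obj (X i)) ⟶ P.fiberFunctor.obj ((tensor z).obj X) :=
  desc (X := fun i => P.fiberFunctor.obj (X i)) (Z := P.fiberFunctor.obj ((tensor z).obj X))
    (P.fiberTensor z X) (hP z X)

lemma fiberXi_pure {n : ℕ} (z : O.Op n) (X : Fin n → I) (a : ∀ k, P.proj.Fiber (X k)) :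
    CSet.toFun (fiberXi hP z X) (pure (X := fun i => P.fiberFunctor.obj (X i)) a) =
      P.fiberTensor z X a :=
  desc_pure (X := fun i => P.fiberFunctor.obj (X i)) (Z := P.fiberFunctor.obj ((tensor z).obj X))
    _ _ a

/-- Morphisms out of a tensor product agree once they agree on pure tensors, and there each axiom
becomes one of the identities for `fiberTensor` proved above. -/
lemma fiberXi_isLax : IsLax O P.fiberFunctor (fun z X => fiberXi hP z X) where
  naturality z X Y f := tensor_ext fun a => by
    have h1 := tensorMap_pure (fun i => P.fiberFunctor.map (f i)) a
    refine (congrArg (CSet.toFun (fiberXi hP z Y)) h1).trans ((fiberXi_pure hP z Y _).trans ?_)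
    refine (P.fiberTensor_push z f a).symm.trans ?_
    exact congrArg (CSet.toFun (P.fiberFunctor.map ((tensor z).map f))) (fiberXi_pure hP z X a).symm
  unit X := tensor_ext fun a => by
    refine (fiberXi_pure hP O.unit X a).trans (Subtype.ext ?_)
    refine (P.fiberTensor_unit X a).trans (P.fiberFunctor_eqToHom ?_ _ (a 0)).symm
    exact congrArg (fun T => T.obj X) (tensor_unit (O := O) (C := I)).symm
  perm σ z X := tensor_ext fun y => by
    -- Writing the tuple as `a ∘ σ` allows the symmetry to be evaluated by `tensorPerm_pure`.
    obtain ⟨a, rfl⟩ := exists_reindex σ (X := fun i => P.fiberFunctor.obj (X i)) y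
    refine (congrArg (CSet.toFun (P.fiberFunctor.map (permIso σ z X).hom))
      (fiberXi_pure hP z (fun i => X (σ i)) fun i => a (σ i))).trans ?_
    refine (P.fiberTensor_perm σ z X a).trans ((fiberXi_pure hP _ X a).symm.trans ?_)
    exact congrArg (CSet.toFun (fiberXi hP (O.relabel σ z) X))
      (tensorPerm_pure σ (fun i => P.fiberFunctor.obj (X i)) a).symm
  -- The source is an iterated tensor product, so the test elements are tensors of pure tensors.
  comp {m n} z x X := tensor_ext₂ fun a => by
    have h1 := tensorMap_pure (fun i => fiberXi hP (x i) (X i)) fun i => pure (a i)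
    have h2 : (fun i => CSet.toFun (fiberXi hP (x i) (X i)) (pure (a i))) =
        fun i => P.fiberTensor (x i) (X i) (a i) := funext fun i => fiberXi_pure hP (x i) (X i) (a i)
    have h3 := fiberXi_pure hP z (fun i => (tensor (x i)).obj (X i))
      fun i => P.fiberTensor (x i) (X i) (a i)
    have h4 := (congrArg (CSet.toFun (fiberXi hP z fun i => (tensor (x i)).obj (X i)))
      (h1.trans (congrArg pure h2))).trans h3
    refine (congrArg (CSet.toFun (P.fiberFunctor.map (compIso z x X).hom)) h4).trans ?_
    refine (P.fiberTensor_comp z x X a).trans ((fiberXi_pure hP _ (flat X) _).symm.trans ?_)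
    exact congrArg (CSet.toFun (fiberXi hP (O.comp z x) (flat X)))
      (tensorCompHom_pure (fun i j => P.fiberFunctor.obj (X i j)) a).symm

/-- The lax `O`-monoidal functor of fibres of an `O`-convex fibration. -/
noncomputable def fiberLax : LaxOFunctor O I CSet.{u} where
  toFunctor := P.fiberFunctor
  ξ z X := fiberXi hP z X
  isLax := fiberXi_isLax hP

/-! ### Morphisms of `O`-convex fibrations -/

/-- A functor over `I` that commutes with the operations on objects and is convex on the fibres
over objects is a morphism of `O`-convex fibrations. -/
def homOfObj {P Q : OFCFib O I} (K : P.Total ⥤ Q.Total) (hK : K ⋙ Q.proj = P.proj)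
    (h : ∀ {n : ℕ} (z : O.Op n) (X : Fin n → P.Total),
      (tensor z).obj (fun i => K.obj (X i)) = K.obj ((tensor z).obj X))
    (hc : ∀ c : I, IsAffineMap ℝ≥0 (fiberMap K hK c)) : P ⟶ Q where
  functor := K
  comm := hK
  strict := IsStrict.of_obj P.strict Q.strict Q.discrete hK h
  obj_affine := hc
  -- Morphisms over `f` are determined by their sources and the source map is convex, so it suffices
  -- to check convexity on sources.
  mor_affine {c _} f := affine_of_injective (Q.convex.src_affine f) (Q.discrete.src_injective f)
    ((hc c).comp (P.convex.src_affine f))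

lemma hom_ext_obj {P Q : OFCFib O I} {f g : P ⟶ Q}
    (h : ∀ e, f.functor.obj e = g.functor.obj e) : f = g :=
  OFCFib.Hom.ext (Q.discrete.functor_ext (f.comm.trans g.comm.symm) h)

lemma fiberMap_fiberTensor {P Q : OFCFib O I} (f : P ⟶ Q) {n : ℕ} (z : O.Op n) (X : Fin n → I)
    (a : ∀ k, P.proj.Fiber (X k)) :
    fiberMap f.functor f.comm _ (P.fiberTensor z X a) =
      Q.fiberTensor z X fun k => fiberMap f.functor f.comm _ (a k) := by
  obtain ⟨h, -⟩ := f.strict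
  exact Subtype.ext (h z fun k => (a k).1).symm

/-- A functor over `I` carries lifts of `g` to lifts of `g`. This is the source of naturality in the
proof of fullness. -/
lemma fiberMap_push {P Q : OFCFib O I} (f : P ⟶ Q) {c d : I} (g : c ⟶ d)
    (a : P.proj.Fiber c) :
    Q.discrete.push g (fiberMap f.functor f.comm c a) =
      fiberMap f.functor f.comm d (P.discrete.push g a) :=
  Q.discrete.push_eq (isHomLift_map f.functor f.comm (P.discrete.toPush_lift g a))

end OFCFib

/-! ### Fullness and essential surjectivity -/

namespace Gr

/-- Under the identification of fibres with values of `F`, the abstract transport is the action of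
`F` on morphisms. -/
lemma fiberEquiv_push (F : LaxOFunctor O I CSet.{u}) {c d : I} (f : c ⟶ d)
    (a : (proj F).Fiber c) :
    fiberEquiv F d ((proj_discrete F).push f a) =
      CSet.toFun (F.toFunctor.map f) (fiberEquiv F c a) :=
  (fiberEquiv_tgt F f _).trans
    (congrArg (fun b => CSet.toFun (F.toFunctor.map f) (fiberEquiv F c b))
      ((proj_discrete F).liftFrom_src f a))

lemma fiberEquiv_symm_affine (F : LaxOFunctor O I CSet.{u}) (c : I) :
    IsAffineMap ℝ≥0 (N := (toOFCFib F).proj.Fiber c) fun x => (fiberEquiv F c).symm x :=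
  affine_of_injective (B := (toOFCFib F).proj.Fiber c) (fiberEquiv_affine F c)
    (fiberEquiv F c).injective
    (affine_congr (A := F.toFunctor.obj c) IsAffineMap.id (fiberEquiv F c).apply_symm_apply)

/-! ### Fullness: recovering the transformation from its effect on fibres -/

section Preimage

variable {F G : LaxOFunctor O I CSet.{u}} (h : toOFCFib F ⟶ toOFCFib G)

/-- The map `F(c) → G(c)` induced by a morphism of Grothendieck constructions. -/
noncomputable def fiberHom (c : I) (x : F.toFunctor.obj c) : G.toFunctor.obj c :=
  fiberEquiv G c (fiberMap h.functor h.comm c ((fiberEquiv F c).symm x))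

lemma fiberHom_affine (c : I) : IsAffineMap ℝ≥0 (fiberHom h c) :=
  (fiberEquiv_affine G c).comp ((h.obj_affine c).comp (fiberEquiv_symm_affine F c))

lemma fiberHom_fiberEquiv (c : I) (a : (toOFCFib F).proj.Fiber c) :
    fiberHom h c (fiberEquiv F c a) = fiberEquiv G c (fiberMap h.functor h.comm c a) :=
  congrArg (fun b => fiberEquiv G c (fiberMap h.functor h.comm c b))
    ((fiberEquiv F c).symm_apply_apply a)

lemma fiberHom_naturality {c d : I} (f : c ⟶ d) (x : F.toFunctor.obj c) :
    fiberHom h d (CSet.toFun (F.toFunctor.map f) x) =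
      CSet.toFun (G.toFunctor.map f) (fiberHom h c x) := by
  obtain ⟨a, rfl⟩ := (fiberEquiv F c).surjective x
  rw [← fiberEquiv_push]
  refine (fiberHom_fiberEquiv h d _).trans ?_
  refine (congrArg (fiberEquiv G d) (OFCFib.fiberMap_push h f a).symm).trans ?_
  refine (fiberEquiv_push G f _).trans (congrArg (CSet.toFun (G.toFunctor.map f)) ?_)
  exact (fiberHom_fiberEquiv h c a).symm

/-- After identifying the `x k` with objects of the fibres, both occurrences of `xi` become
operations on the total categories, and the claim is that `h` is strict on objects. -/
lemma fiberHom_xi {n : ℕ} (z : O.Op n) (X : Fin n → I) (x : ∀ k, F.toFunctor.obj (X k)) :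
    xi G z X (fun k => fiberHom h (X k) (x k)) = fiberHom h _ (xi F z X x) := by
  obtain ⟨a, rfl⟩ : ∃ a : ∀ k, (toOFCFib F).proj.Fiber (X k),
      x = fun k => fiberEquiv F (X k) (a k) :=
    ⟨fun k => (fiberEquiv F (X k)).symm (x k),
      funext fun k => ((fiberEquiv F (X k)).apply_symm_apply (x k)).symm⟩
  rw [← fiberEquiv_fiberTensor, fiberHom_fiberEquiv, OFCFib.fiberMap_fiberTensor,
    fiberEquiv_fiberTensor]
  exact congrArg (xi G z X) (funext fun k => fiberHom_fiberEquiv h (X k) (a k))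

/-- The `O`-monoidal transformation induced by a morphism of Grothendieck constructions. -/
noncomputable def preimage : F ⟶ G where
  toNatTrans :=
    { app := fun c => CSet.ofFun (fiberHom h c) (fiberHom_affine h c)
      naturality := fun _ _ f => CSet.hom_ext (fiberHom_naturality h f) }
  comm z X := tensor_ext fun x =>
    (congrArg (CSet.toFun (G.ξ z X)) (tensorMap_pure _ x)).trans (fiberHom_xi h z X x)

/-- Only objects `(c, x)` need comparing; there the identification of the fibre of `G` with `G(c)`
cancels against its inverse. -/
lemma mapHom_preimage : mapHom (preimage h) = h :=
  OFCFib.hom_ext_obj fun ⟨c, x⟩ =>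
    congrArg Subtype.val ((fiberEquiv G c).symm_apply_apply
      (fiberMap h.functor h.comm c ((fiberEquiv F c).symm x)))

end Preimage

/-! ### Essential surjectivity: a fibration is rebuilt from its fibres -/

section Fibers

variable {P : OFCFib O I} (hP : IsOConvex P)

/-- The comparison from the Grothendieck construction of the fibres to a fibration. -/
noncomputable def comparison : Gr (OFCFib.fiberLax hP) ⥤ P.Total where
  obj p := Subtype.val (p := fun e => P.proj.obj e = p.1) p.2
  -- A morphism `p ⟶ q` consists of `f.1` and the equation `f.2` saying that the transport of `p.2`
  -- along `f.1` is `q.2`; the canonical lift is corrected by this equation so as to end at `q.2`.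
  -- Functoriality is then uniqueness of lifts.
  map {p q} f := P.discrete.toPush f.1 p.2 ≫
    eqToHom (congrArg (Subtype.val (p := fun e => P.proj.obj e = q.1)) f.2)
  map_id p := P.discrete.hom_ext (f := 𝟙 p.1)
    ((IsHomLift.eqToHom_comp_lift_iff P.proj _ _ _).2 (P.discrete.toPush_lift _ _))
    (IsHomLift.id p.2.2)
  map_comp f g := P.discrete.hom_ext (f := f.1 ≫ g.1)
    ((IsHomLift.eqToHom_comp_lift_iff P.proj _ _ _).2 (P.discrete.toPush_lift _ _))
    (@IsHomLift.comp _ _ _ _ P.proj _ _ _ _ _ _ f.1 g.1 _ _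
      ((IsHomLift.eqToHom_comp_lift_iff P.proj _ _ _).2 (P.discrete.toPush_lift _ _))
      ((IsHomLift.eqToHom_comp_lift_iff P.proj _ _ _).2 (P.discrete.toPush_lift _ _)))

lemma comparison_proj : comparison hP ⋙ P.proj = proj (OFCFib.fiberLax hP) :=
  CategoryTheory.Functor.ext (fun p => p.2.2) fun p _ f =>
    @IsHomLift.fac' _ _ _ _ P.proj _ _ _ _ f.1 ((comparison hP).map f)
      ((IsHomLift.eqToHom_comp_lift_iff P.proj _ _ _).2 (P.discrete.toPush_lift f.1 p.2))

/-- The section of the comparison. -/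
noncomputable def comparisonInv : P.Total ⥤ Gr (OFCFib.fiberLax hP) where
  obj e := ⟨P.proj.obj e, (⟨e, rfl⟩ : P.proj.Fiber _)⟩
  -- The morphism `φ` itself is a lift of its image, which shows that transport sends `e` to `e'`.
  map {e e'} φ := ⟨P.proj.map φ, P.discrete.push_eq (a := ⟨e, rfl⟩) (b := ⟨e', rfl⟩)
    (IsHomLift.map P.proj φ)⟩
  map_id e := hom_ext _ (P.proj.map_id e)
  map_comp φ ψ := hom_ext _ (P.proj.map_comp φ ψ)

/-- The second component of the operation on the right is `ξ` of a pure tensor, which by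
construction is the operation of the total category of `P`. -/
lemma comparison_tensor {n : ℕ} (z : O.Op n) (X : Fin n → Gr (OFCFib.fiberLax hP)) :
    (tensor z).obj (fun i => (comparison hP).obj (X i)) =
      (comparison hP).obj ((tensor z).obj X) :=
  congrArg Subtype.val (OFCFib.fiberXi_pure hP z (fun i => (X i).1) fun i => (X i).2).symm

lemma comparisonInv_comparison_obj (e : P.Total) :
    (comparison hP).obj ((comparisonInv hP).obj e) = e := rfl

lemma comparison_comparisonInv_obj (p : Gr (OFCFib.fiberLax hP)) :
    (comparisonInv hP).obj ((comparison hP).obj p) = p := by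
  obtain ⟨c, e, rfl⟩ := p
  rfl

/-- Formal from `comparison_tensor`: the two functors are mutually inverse on objects, and an
inverse of an operation-preserving bijection preserves the operations. -/
lemma comparisonInv_tensor {n : ℕ} (z : O.Op n) (X : Fin n → P.Total) :
    (tensor z).obj (fun i => (comparisonInv hP).obj (X i)) =
      (comparisonInv hP).obj ((tensor z).obj X) := by
  rw [← comparison_comparisonInv_obj hP ((tensor z).obj fun i => (comparisonInv hP).obj (X i)),
    ← comparison_tensor]
  rfl

/-- Over `c` the value of the functor of fibres is the fibre of `P` itself, so the comparison
restricts to the convex bijection `fiberEquiv`; convexity of the comparison follows. -/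
lemma comparison_fiberMap (c : I) (a : (toOFCFib (OFCFib.fiberLax hP)).proj.Fiber c) :
    fiberMap (π := (toOFCFib (OFCFib.fiberLax hP)).proj) (comparison hP) (comparison_proj hP) c a =
      fiberEquiv (OFCFib.fiberLax hP) c a := by
  obtain ⟨x, rfl⟩ := (fiberEquiv (OFCFib.fiberLax hP) c).symm.surjective a
  exact ((fiberEquiv (OFCFib.fiberLax hP) c).apply_symm_apply x).symm

lemma comparisonInv_fiberMap (c : I) (a : P.proj.Fiber c) :
    fiberMap (π' := (toOFCFib (OFCFib.fiberLax hP)).proj) (comparisonInv hP) rfl c a =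
      (fiberEquiv (OFCFib.fiberLax hP) c).symm a := by
  obtain ⟨e, rfl⟩ := a
  rfl

/-- An `O`-convex fibration is isomorphic to the Grothendieck construction of its fibres. -/
noncomputable def comparisonIso : toOFCFib (OFCFib.fiberLax hP) ≅ P where
  hom := OFCFib.homOfObj (P := toOFCFib (OFCFib.fiberLax hP)) (comparison hP) (comparison_proj hP)
    (comparison_tensor hP)
    fun c => affine_congr (fiberEquiv_affine (OFCFib.fiberLax hP) c) (comparison_fiberMap hP c)
  inv := OFCFib.homOfObj (Q := toOFCFib (OFCFib.fiberLax hP)) (comparisonInv hP) rfl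
    (comparisonInv_tensor hP)
    fun c => affine_congr (fiberEquiv_symm_affine (OFCFib.fiberLax hP) c)
      (comparisonInv_fiberMap hP c)
  hom_inv_id := OFCFib.hom_ext_obj (comparison_comparisonInv_obj hP)
  inv_hom_id := OFCFib.hom_ext_obj (comparisonInv_comparison_obj hP)

end Fibers

end Gr

/-! ### The equivalence -/

instance : (convexGrothendieck O I).Faithful where
  map_injective {F G μ ν} h := by
    refine LaxOFunctor.Hom.ext (NatTrans.ext (funext fun c => CSet.hom_ext fun x => ?_))
    have h1 : Gr.map μ = Gr.map ν := congrArg (fun t => OFCFib.Hom.functor t.hom) h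
    -- The induced functor sends `(c, x)` to `(c, μ_c(x))`, so the second component of this equality
    -- of pairs is the desired one.
    have h2 := Functor.congr_obj h1 ⟨c, x⟩
    exact eq_of_heq (Sigma.mk.inj h2).2

instance : (convexGrothendieck O I).Full where
  map_surjective h := ⟨Gr.preimage h.hom,
    ObjectProperty.hom_ext _ (Gr.mapHom_preimage h.hom)⟩

instance : (convexGrothendieck O I).EssSurj where
  mem_essImage P := ⟨OFCFib.fiberLax P.property,
    ⟨ObjectProperty.isoMk _ (Gr.comparisonIso P.property)⟩⟩

end ConvexGC

/-- The fields of `IsEquivalence` default to instance search, which finds the faithfulness, fullness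
and essential surjectivity instances above. -/
theorem mainTheorem1 (O : ConvexGC.SymmOperad.{w}) (I : Type u) [SmallCategory I]
    [ConvexGC.OMonoidalCategory O I] :
    (ConvexGC.convexGrothendieck O I).IsEquivalence where
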